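/- Let $\mathbb K$ be $\mathbb R$ or $\mathbb C$. Let $M$ be a finite-dimensional, second countable, Hausdorff smooth manifold (without boundary), and let $E$ and $F$ be smooth $\mathbb K$-vector bundles of finite rank over $M$. Let $C^\infty(M)$ be the algebra of smooth functions $M\to\mathbb K$. For a smooth vector bundle $G$ over $M$ with typical fiber $\mathbb G$, equipped with a norm, let $\Gamma(G)$ be the $C^\infty(M)$-module of smooth sections of $G$, endowed with the Fréchet topology defined by the seminorms $$ s\mapsto \sup_{x\in K,\ |\alpha|\le k}\bigl\|\partial^\alpha(\mathrm{pr}_2\circ\tau\circ s\circ\varphi^{-1})(\varphi(x))\bigr\| ,$$ where $\varphi\colon U\to\mathbb R^n$ runs through the charts of $M$, $\tau\colon G|_{U'}\to U'\times\mathbb G$ through the local trivializations of $G$, $K$ through the compact subsets of $U\cap U'$, and $k$ through $\mathbb N_0$. Let $\Gamma(E)\otimes_\pi\Gamma(F)$ be the algebraic tensor product over $\mathbb K$ with the finest locally convex vector space topology for which $(s,t)\mapsto s\otimes t$ is continuous on $\Gamma(E)\times\Gamma(F)$. Let $J$ be the closure in it of the subspace generated by all elements $(fs)\otimes t-s\otimes(ft)$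 with $f\in C^\infty(M)$, $s\in\Gamma(E)$, $t\in\Gamma(F)$, and let $$\Gamma(E)\otimes^\pi_{C^\infty(M)}\Gamma(F):=(\Gamma(E)\otimes_\pi\Gamma(F))/J$$ with the quotient topology. It receives a canonical map from the algebraic tensor product $\Gamma(E)\otimes_{C^\infty(M)}\Gamma(F)$, which sends $s\otimes t$ to the class of $s\otimes t$. Theorem 6.1. The canonical $C^\infty(M)$-linear map $$\Gamma(E)\otimes_{C^\infty(M)}\Gamma(F)\to\Gamma(E\otimes F),\qquad s\otimes t\mapsto\bigl(x\mapsto s(x)\otimes t(x)\bigr),$$ is bijective, and it induces a homeomorphism $\Gamma(E)\otimes^\pi_{C^\infty(M)}\Gamma(F)\cong\Gamma(E\otimes F)$: there is a $\mathbb K$-linear homeomorphism $\Phi\colon\Gamma(E)\otimes^\pi_{C^\infty(M)}\Gamma(F)\to\Gamma(E\otimes F)$ whose composition with the canonical map $\Gamma(E)\otimes_{C^\infty(M)}\Gamma(F)\to\Gamma(E)\otimes^\pi_{C^\infty(M)}\Gamma(F)$ is the bijection above. -/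

import Mathlib

open Bundle Set Topology Module
open scoped Bundle Manifold ContDiff TensorProduct

set_option maxSynthPendingDepth 3
set_option linter.unusedSectionVars false

noncomputable section

section ProjectiveTensorProduct

/-- The algebraic tensor product `M ⊗ N` of two vector spaces over `𝕂`, as carrier of the
projective tensor product topology. -/
def ProjTensor (𝕂 M N : Type*) [RCLike 𝕂] [AddCommGroup M] [Module 𝕂 M]
    [AddCommGroup N] [Module 𝕂 N] : Type _ := M ⊗[𝕂] N

variable (𝕂 : Type*) [RCLike 𝕂]
  (M : Type*) [AddCommGroup M] [Module 𝕂 M] [Module ℝ M] [IsScalarTower ℝ 𝕂 M]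
  (N : Type*) [AddCommGroup N] [Module 𝕂 N]

instance : AddCommGroup (ProjTensor 𝕂 M N) := inferInstanceAs (AddCommGroup (M ⊗[𝕂] N))
instance : Module 𝕂 (ProjTensor 𝕂 M N) := inferInstanceAs (Module 𝕂 (M ⊗[𝕂] N))
instance : Module ℝ (ProjTensor 𝕂 M N) := inferInstanceAs (Module ℝ (M ⊗[𝕂] N))
instance : IsScalarTower ℝ 𝕂 (ProjTensor 𝕂 M N) :=
  inferInstanceAs (IsScalarTower ℝ 𝕂 (M ⊗[𝕂] N))

/-- The canonical bilinear map `(m, n) ↦ m ⊗ n` into `M ⊗ N`. -/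
def ProjTensor.mk : M →ₗ[𝕂] N →ₗ[𝕂] ProjTensor 𝕂 M N := TensorProduct.mk 𝕂 M N

variable [TopologicalSpace M] [TopologicalSpace N]

/-- The projective topology on `M ⊗ N`: the finest topology on `M ⊗ N` which is a vector space
topology, is locally convex, and makes the canonical map `M × N → M ⊗ N` continuous.
(In Mathlib's order on topologies, the infimum of a family is the coarsest topology which is
finer than all of its members.) -/
instance ProjTensor.instTopologicalSpace : TopologicalSpace (ProjTensor 𝕂 M N) :=
  sInf {t | @IsTopologicalAddGroup _ t _ ∧ @ContinuousSMul 𝕂 _ _ _ t ∧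
    @LocallyConvexSpace ℝ (ProjTensor 𝕂 M N) _ _ _ _ t ∧
    @Continuous (M × N) _ _ t fun p => ProjTensor.mk 𝕂 M N p.1 p.2}

instance : IsTopologicalAddGroup (ProjTensor 𝕂 M N) :=
  topologicalAddGroup_sInf fun _ h => h.1

instance : ContinuousSMul 𝕂 (ProjTensor 𝕂 M N) :=
  continuousSMul_sInf fun _ h => h.2.1

instance : LocallyConvexSpace ℝ (ProjTensor 𝕂 M N) :=
  LocallyConvexSpace.sInf fun _ h => h.2.2.1

theorem ProjTensor.continuous_mk :
    Continuous fun p : M × N => ProjTensor.mk 𝕂 M N p.1 p.2 :=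
  continuous_sInf_rng.2 fun _ h => h.2.2.2

variable (A : Type*) [CommRing A] [Module A M] [Module A N]

/-- The subspace `J₀` of `M ⊗ N` generated by all `(a • m) ⊗ n - m ⊗ (a • n)`. Since `𝕂` commutes
with `A`, the set of generators is stable under scalars, so that this is also the
additive subgroup which they generate. -/
def ProjTensor.balancing : Submodule 𝕂 (ProjTensor 𝕂 M N) :=
  Submodule.span 𝕂 {z | ∃ (a : A) (m : M) (n : N),
    z = ProjTensor.mk 𝕂 M N (a • m) n - ProjTensor.mk 𝕂 M N m (a • n)}

/-- The projective tensor product `M ⊗_A^π N` over `A`: the quotient of the projective tensor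
product `M ⊗_π N` by the closure of `J₀`, with the quotient topology. -/
abbrev ProjTensorOver : Type _ :=
  ProjTensor 𝕂 M N ⧸ (ProjTensor.balancing 𝕂 M N A).topologicalClosure

/-- The canonical map `M ⊗_A N → M ⊗_A^π N` from the algebraic tensor product over `A`, which
sends `m ⊗ n` to the class of `m ⊗ n`. -/
def ProjTensorOver.ofTensor : M ⊗[A] N →+ ProjTensorOver 𝕂 M N A :=
  TensorProduct.liftAddHom
    { toFun := fun m =>
       { toFun := fun n => Submodule.Quotient.mk (ProjTensor.mk 𝕂 M N m n)
         map_zero' := by simp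
         map_add' := fun n n' => by simp }
      map_zero' := by ext n; simp
      map_add' := fun m m' => by ext n; simp }
    fun a m n => (Submodule.Quotient.eq _).2 <|
      Submodule.le_topologicalClosure _ (Submodule.subset_span ⟨a, m, n, rfl⟩)

theorem ProjTensorOver.ofTensor_tmul (m : M) (n : N) :
    ofTensor 𝕂 M N A (m ⊗ₜ n) = Submodule.Quotient.mk (ProjTensor.mk 𝕂 M N m n) := rfl

end ProjectiveTensorProduct

section SmoothFunctions

/-- `𝕂`-valued functions on a real manifold form a ring: multiplication of `𝕂` is real smooth. -/
instance instRCLikeContMDiffRing (𝕂 : Type*) [RCLike 𝕂] : ContMDiffRing 𝓘(ℝ, 𝕂) ∞ 𝕂 :=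
  { instNormedSpaceLieAddGroup with
    contMDiff_mul := by
      have h : ContDiff ℝ ∞ fun p : 𝕂 × 𝕂 => p.1 * p.2 := contDiff_fst.mul contDiff_snd
      rw [contMDiff_iff]
      refine ⟨continuous_mul, fun x y => ?_⟩
      simp only [mfld_simps, chartAt_self_eq]
      rw [contDiffOn_univ]
      exact h }

end SmoothFunctions

section Sections

variable {𝕂 : Type*} [RCLike 𝕂]
  {B : Type*} [NormedAddCommGroup B] [NormedSpace ℝ B]
  {M : Type*} [TopologicalSpace M] [ChartedSpace B M]
  {F : Type*} [NormedAddCommGroup F] [NormedSpace 𝕂 F] [NormedSpace ℝ F] [IsScalarTower ℝ 𝕂 F]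
  {V : M → Type*} [∀ x, AddCommGroup (V x)] [∀ x, Module 𝕂 (V x)] [∀ x, Module ℝ (V x)]
  [∀ x, IsScalarTower ℝ 𝕂 (V x)]
  [TopologicalSpace (TotalSpace F V)] [∀ x, TopologicalSpace (V x)] [FiberBundle F V]
  [VectorBundle 𝕂 F V] [VectorBundle ℝ F V]

theorem ContMDiff.smul_section_of_rclike {f : M → 𝕂} {s : ∀ x, V x}
    (hf : ContMDiff 𝓘(ℝ, B) 𝓘(ℝ, 𝕂) ∞ f)
    (hs : ContMDiff 𝓘(ℝ, B) (𝓘(ℝ, B).prod 𝓘(ℝ, F)) ∞ fun x => TotalSpace.mk' F x (s x)) :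
    ContMDiff 𝓘(ℝ, B) (𝓘(ℝ, B).prod 𝓘(ℝ, F)) ∞ fun x => TotalSpace.mk' F x (f x • s x) := by
  intro x₀
  have hs' := hs x₀
  rw [contMDiffAt_section] at hs' ⊢
  have hsm : ContDiff ℝ ∞ fun p : 𝕂 × F => p.1 • p.2 := contDiff_fst.smul contDiff_snd
  have := hsm.contMDiff.contMDiffAt.comp x₀ ((hf x₀).prodMk_space hs')
  refine this.congr_of_eventuallyEq ?_
  set e := trivializationAt F V x₀
  filter_upwards [e.open_baseSet.mem_nhds (mem_baseSet_trivializationAt F V x₀)] with x hx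
  exact (e.linear 𝕂 hx).2 _ _

/-- Smooth `𝕂`-valued functions act on smooth sections by pointwise multiplication. -/
instance instModuleSmoothFunctions :
    Module C^∞⟮𝓘(ℝ, B), M; 𝓘(ℝ, 𝕂), 𝕂⟯ Cₛ^∞⟮𝓘(ℝ, B); F, V⟯ where
  smul f s := ⟨fun x => f x • s x, f.contMDiff.smul_section_of_rclike s.contMDiff⟩
  one_smul s := by ext x; exact one_smul 𝕂 (s x)
  mul_smul f g s := by ext x; exact mul_smul (f x) (g x) (s x)
  smul_zero f := by ext x; exact smul_zero (f x)
  smul_add f s t := by ext x; exact smul_add (f x) (s x) (t x)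
  add_smul f g s := by ext x; exact add_smul (f x) (g x) (s x)
  zero_smul s := by ext x; exact zero_smul 𝕂 (s x)

/-- Scalars act on smooth sections by pointwise multiplication. -/
instance (priority := 100) instModuleRCLike : Module 𝕂 Cₛ^∞⟮𝓘(ℝ, B); F, V⟯ where
  smul c s := ⟨fun x => c • s x, contMDiff_const.smul_section_of_rclike s.contMDiff⟩
  one_smul s := by ext x; exact one_smul 𝕂 (s x)
  mul_smul f g s := by ext x; exact mul_smul f g (s x)
  smul_zero f := by ext x; exact smul_zero f
  smul_add f s t := by ext x; exact smul_add f (s x) (t x)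
  add_smul f g s := by ext x; exact add_smul f g (s x)
  zero_smul s := by ext x; exact zero_smul 𝕂 (s x)

instance : IsScalarTower ℝ 𝕂 Cₛ^∞⟮𝓘(ℝ, B); F, V⟯ where
  smul_assoc r c s := by ext x; exact smul_assoc r c (s x)

end Sections

section Topology

variable {B : Type*} [NormedAddCommGroup B] [NormedSpace ℝ B]
  {M : Type*} [TopologicalSpace M] [ChartedSpace B M] [IsManifold 𝓘(ℝ, B) ∞ M]
  {F : Type*} [NormedAddCommGroup F] [NormedSpace ℝ F]
  {V : M → Type*} [∀ x, AddCommGroup (V x)] [∀ x, Module ℝ (V x)]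
  [TopologicalSpace (TotalSpace F V)] [∀ x, TopologicalSpace (V x)] [FiberBundle F V]
  [VectorBundle ℝ F V] [ContMDiffVectorBundle ∞ F V 𝓘(ℝ, B)]

/-- The local representation `pr₂ ∘ τ ∘ s ∘ φ⁻¹` of a section `s` with respect to a chart `φ` of
the base and a trivialization `τ` of the bundle. It is meaningful on the open set
`φ (U ∩ U')`, where `U`, `U'` are the domains of `φ` and `τ`. -/
def localRep (φ : OpenPartialHomeomorph M B) (τ : Trivialization F (π F V)) (s : ∀ x, V x) :
    B → F :=
  fun y => (τ ⟨φ.symm y, s (φ.symm y)⟩).2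

theorem localRep_domain_mem_nhds (φ : OpenPartialHomeomorph M B) (τ : Trivialization F (π F V))
    {x : M} (hx : x ∈ φ.source ∩ τ.baseSet) :
    φ.target ∩ φ.symm ⁻¹' τ.baseSet ∈ 𝓝 (φ x) :=
  (φ.symm.isOpen_inter_preimage τ.open_baseSet).mem_nhds
    ⟨φ.map_source hx.1, by simpa [φ.left_inv hx.1] using hx.2⟩

/-- Local representations of smooth sections are smooth. -/
theorem contDiffAt_localRep {φ : OpenPartialHomeomorph M B} (hφ : φ ∈ atlas B M)
    {τ : Trivialization F (π F V)} (hτ : τ ∈ trivializationAtlas F V)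
    (s : Cₛ^∞⟮𝓘(ℝ, B); F, V⟯) {x : M} (hx : x ∈ φ.source ∩ τ.baseSet) :
    ContDiffAt ℝ ∞ (localRep φ τ s) (φ x) := by
  have : MemTrivializationAtlas τ := ⟨hτ⟩
  have h1 : ContMDiffAt 𝓘(ℝ, B) 𝓘(ℝ, F) ∞ (fun x => (τ ⟨x, s x⟩).2) (φ.symm (φ x)) := by
    rw [φ.left_inv hx.1]
    exact (τ.contMDiffAt_section_iff hx.2).1 (s.contMDiff x)
  have h2 : ContMDiffAt 𝓘(ℝ, B) 𝓘(ℝ, B) ∞ φ.symm (φ x) :=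
    (contMDiffOn_symm_of_mem_maximalAtlas
      (StructureGroupoid.subset_maximalAtlas _ hφ)).contMDiffAt
        (φ.open_target.mem_nhds (φ.map_source hx.1))
  exact (h1.comp _ h2).contDiffAt

variable (F V) in
/-- The data on which a seminorm depends: a chart of `M`, a trivialization of `V`, a compact
subset `K` of the intersection of their domains, and an order of differentiation. -/
structure SeminormIndex where
  /-- the chart of the base -/
  chart : OpenPartialHomeomorph M B
  chart_mem : chart ∈ atlas B M
  /-- the trivialization of the bundle -/
  triv : Trivialization F (π F V)
  triv_mem : triv ∈ trivializationAtlas F V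
  /-- the compact set -/
  K : Set M
  isCompact_K : IsCompact K
  K_subset : K ⊆ chart.source ∩ triv.baseSet
  /-- the order of differentiation -/
  order : ℕ

theorem bddAbove_localRep (i : SeminormIndex F V (B := B)) (s : Cₛ^∞⟮𝓘(ℝ, B); F, V⟯) :
    BddAbove (range fun x : i.K =>
      ‖iteratedFDeriv ℝ i.order (localRep i.chart i.triv s) (i.chart x)‖) := by
  have hc : ContinuousOn
      (fun x => ‖iteratedFDeriv ℝ i.order (localRep i.chart i.triv s) (i.chart x)‖) i.K := by
    intro x hx
    have h := (contDiffAt_localRep i.chart_mem i.triv_mem s (i.K_subset hx))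
    have h1 : ContinuousAt (iteratedFDeriv ℝ i.order (localRep i.chart i.triv s)) (i.chart x) :=
      (h.iteratedFDeriv_right (m := 0) (i := i.order) (by simp; exact_mod_cast le_top)).continuousAt
    exact (h1.norm.comp (i.chart.continuousAt (i.K_subset hx).1)).continuousWithinAt
  simpa [image_eq_range] using (i.isCompact_K.image_of_continuousOn hc).bddAbove

/-- The seminorm `s ↦ sup_{x ∈ K} ‖D^j (pr₂ ∘ τ ∘ s ∘ φ⁻¹) (φ x)‖`. The usual seminorms, with a
maximum over all partial derivatives of order at most `k`, are equivalent to the maximum of these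
over `j ≤ k`, so that both families define the same topology. -/
def sectionSeminorm (i : SeminormIndex F V (B := B)) : Seminorm ℝ Cₛ^∞⟮𝓘(ℝ, B); F, V⟯ :=
  Seminorm.of
    (fun s => ⨆ x : i.K, ‖iteratedFDeriv ℝ i.order (localRep i.chart i.triv s) (i.chart x)‖)
    (fun s t => by
      have : MemTrivializationAtlas i.triv := ⟨i.triv_mem⟩
      refine Real.iSup_le (fun x => ?_) (add_nonneg (Real.iSup_nonneg fun _ => norm_nonneg _)
        (Real.iSup_nonneg fun _ => norm_nonneg _))
      have hx := i.K_subset x.2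
      have hs := (contDiffAt_localRep i.chart_mem i.triv_mem s hx).of_le
        (m := i.order) (by exact_mod_cast le_top)
      have ht := (contDiffAt_localRep i.chart_mem i.triv_mem t hx).of_le
        (m := i.order) (by exact_mod_cast le_top)
      have heq : localRep i.chart i.triv (s + t) =ᶠ[𝓝 (i.chart x)]
          localRep i.chart i.triv s + localRep i.chart i.triv t := by
        filter_upwards [localRep_domain_mem_nhds i.chart i.triv hx] with y hy
        exact (i.triv.linear ℝ hy.2).1 _ _
      rw [ContMDiffSection.coe_add, (heq.iteratedFDeriv ℝ i.order).eq_of_nhds,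
        iteratedFDeriv_add_apply hs ht]
      exact (norm_add_le _ _).trans (add_le_add (le_ciSup (bddAbove_localRep i s) x)
        (le_ciSup (bddAbove_localRep i t) x)))
    (fun c s => by
      have : MemTrivializationAtlas i.triv := ⟨i.triv_mem⟩
      rw [Real.mul_iSup_of_nonneg (norm_nonneg c)]
      congr 1
      ext x
      have hx := i.K_subset x.2
      have hs := (contDiffAt_localRep i.chart_mem i.triv_mem s hx).of_le
        (m := i.order) (by exact_mod_cast le_top)
      have heq : localRep i.chart i.triv (c • ⇑s) =ᶠ[𝓝 (i.chart x)]
          c • localRep i.chart i.triv s := by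
        filter_upwards [localRep_domain_mem_nhds i.chart i.triv hx] with y hy
        exact (i.triv.linear ℝ hy.2).2 _ _
      rw [ContMDiffSection.coe_smul, (heq.iteratedFDeriv ℝ i.order).eq_of_nhds,
        iteratedFDeriv_const_smul_apply hs, norm_smul])

variable (B F V) in
/-- The family of seminorms defining the topology on the space of smooth sections. -/
def sectionSeminorms :
    SeminormFamily ℝ Cₛ^∞⟮𝓘(ℝ, B); F, V⟯ (SeminormIndex F V (B := B)) :=
  sectionSeminorm

/-- The Fréchet topology on the space `Γ(V)` of smooth sections: the coarsest locally convex
topology for which all local representations `s ↦ pr₂ ∘ τ ∘ s ∘ φ⁻¹` are continuous into the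
spaces of smooth functions, with uniform convergence of all derivatives on compact sets. -/
instance instTopologicalSpaceSections : TopologicalSpace Cₛ^∞⟮𝓘(ℝ, B); F, V⟯ :=
  (sectionSeminorms B F V).moduleFilterBasis.topology

theorem withSeminorms_sections : WithSeminorms (sectionSeminorms B F V) := ⟨rfl⟩

end Topology

section TensorModel

/-- The tensor product of two model fibers. -/
def TensorModel (𝕂 F₁ F₂ : Type*) [RCLike 𝕂] [NormedAddCommGroup F₁] [NormedSpace 𝕂 F₁]
    [NormedAddCommGroup F₂] [NormedSpace 𝕂 F₂] : Type _ := F₁ ⊗[𝕂] F₂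

variable (𝕂 F₁ F₂ : Type*) [RCLike 𝕂]
  [NormedAddCommGroup F₁] [NormedSpace 𝕂 F₁] [FiniteDimensional 𝕂 F₁]
  [NormedAddCommGroup F₂] [NormedSpace 𝕂 F₂] [FiniteDimensional 𝕂 F₂]

instance : AddCommGroup (TensorModel 𝕂 F₁ F₂) := inferInstanceAs (AddCommGroup (F₁ ⊗[𝕂] F₂))
instance : Module 𝕂 (TensorModel 𝕂 F₁ F₂) := inferInstanceAs (Module 𝕂 (F₁ ⊗[𝕂] F₂))
instance : FiniteDimensional 𝕂 (TensorModel 𝕂 F₁ F₂) :=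
  inferInstanceAs (FiniteDimensional 𝕂 (F₁ ⊗[𝕂] F₂))

/-- Evaluation of continuous bilinear forms on tensors, `t ↦ (β ↦ β t)`. -/
def TensorModel.eval :
    TensorModel 𝕂 F₁ F₂ →ₗ[𝕂] (F₁ →L[𝕂] F₂ →L[𝕂] 𝕂) →L[𝕂] 𝕂 :=
  TensorProduct.lift <| LinearMap.mk₂ 𝕂
    (fun v w => (ContinuousLinearMap.apply 𝕂 𝕂 w).comp (ContinuousLinearMap.apply 𝕂 _ v))
    (fun v v' w => by ext β; simp) (fun c v w => by ext β; simp)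
    (fun v w w' => by ext β; simp) (fun c v w => by ext β; simp)

theorem TensorModel.eval_injective : Function.Injective (TensorModel.eval 𝕂 F₁ F₂) := by
  rw [← LinearMap.ker_eq_bot, LinearMap.ker_eq_bot']
  intro t ht
  refine (Module.forall_dual_apply_eq_zero_iff 𝕂 t).1 fun φ => ?_
  let β : F₁ →L[𝕂] F₂ →L[𝕂] 𝕂 :=
    (TensorProduct.curry (show F₁ ⊗[𝕂] F₂ →ₗ[𝕂] 𝕂 from φ)).toContinuousBilinearMap
  have h : (ContinuousLinearMap.apply 𝕂 𝕂 β).toLinearMap ∘ₗ TensorModel.eval 𝕂 F₁ F₂ = φ := by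
    refine TensorProduct.ext' fun v w => ?_
    simp [TensorModel.eval, β]
    rfl
  rw [← h]
  simp [ht]

/-- The projective norm on the tensor product of two finite-dimensional normed spaces, written
as `‖t‖ = sup {|β t| : β a bilinear form of norm at most one}`. -/
instance : NormedAddCommGroup (TensorModel 𝕂 F₁ F₂) :=
  NormedAddCommGroup.induced _ _ (TensorModel.eval 𝕂 F₁ F₂) (TensorModel.eval_injective 𝕂 F₁ F₂)

instance : NormedSpace 𝕂 (TensorModel 𝕂 F₁ F₂) :=
  NormedSpace.induced 𝕂 _ _ (TensorModel.eval 𝕂 F₁ F₂)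

variable [NormedSpace ℝ F₁] [IsScalarTower ℝ 𝕂 F₁]

instance : Module ℝ (TensorModel 𝕂 F₁ F₂) := inferInstanceAs (Module ℝ (F₁ ⊗[𝕂] F₂))
instance : IsScalarTower ℝ 𝕂 (TensorModel 𝕂 F₁ F₂) :=
  inferInstanceAs (IsScalarTower ℝ 𝕂 (F₁ ⊗[𝕂] F₂))
instance : NormedSpace ℝ (TensorModel 𝕂 F₁ F₂) where
  norm_smul_le r t := by
    rw [← algebraMap_smul 𝕂 r t]
    exact (norm_smul_le _ _).trans (by simp)
instance : FiniteDimensional ℝ (TensorModel 𝕂 F₁ F₂) := Module.Finite.trans 𝕂 _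

/-- The canonical bilinear map `(v, w) ↦ v ⊗ w`, as a continuous bilinear map. -/
def TensorModel.mkL : F₁ →L[𝕂] F₂ →L[𝕂] TensorModel 𝕂 F₁ F₂ :=
  LinearMap.toContinuousBilinearMap (TensorProduct.mk 𝕂 F₁ F₂)

/-- The map `(A, A') ↦ A ⊗ A'` on endomorphisms, as a continuous bilinear map. -/
def TensorModel.mapL : (F₁ →L[𝕂] F₁) →L[𝕂] (F₂ →L[𝕂] F₂) →L[𝕂]
    (TensorModel 𝕂 F₁ F₂ →L[𝕂] TensorModel 𝕂 F₁ F₂) :=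
  LinearMap.toContinuousBilinearMap <| LinearMap.mk₂ 𝕂
    (fun A A' => LinearMap.toContinuousLinearMap
      (show TensorModel 𝕂 F₁ F₂ →ₗ[𝕂] TensorModel 𝕂 F₁ F₂ from
        TensorProduct.map A.toLinearMap A'.toLinearMap))
    (fun A B A' => by
      ext t; exact LinearMap.congr_fun (TensorProduct.map_add_left A.toLinearMap B A'.toLinearMap) t)
    (fun c A A' => by
      ext t; exact LinearMap.congr_fun (TensorProduct.map_smul_left c A.toLinearMap A'.toLinearMap) t)
    (fun A A' B' => by
      ext t; exact LinearMap.congr_fun (TensorProduct.map_add_right A.toLinearMap A'.toLinearMap B') t)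
    (fun c A A' => by
      ext t; exact LinearMap.congr_fun (TensorProduct.map_smul_right c A.toLinearMap A'.toLinearMap) t)

end TensorModel

section TensorBundle

variable (𝕂 : Type*) [RCLike 𝕂] {M : Type*}

/-- The fibers `V x ⊗ W x` of the tensor product of two vector bundles. -/
def TensorBundle (V W : M → Type*) [∀ x, AddCommGroup (V x)] [∀ x, Module 𝕂 (V x)]
    [∀ x, AddCommGroup (W x)] [∀ x, Module 𝕂 (W x)] : M → Type _ :=
  fun x => V x ⊗[𝕂] W x

section fibers

variable (V W : M → Type*) [∀ x, AddCommGroup (V x)] [∀ x, Module 𝕂 (V x)]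
    [∀ x, AddCommGroup (W x)] [∀ x, Module 𝕂 (W x)] (x : M)

instance : AddCommGroup (TensorBundle 𝕂 V W x) := inferInstanceAs (AddCommGroup (V x ⊗[𝕂] W x))
instance : Module 𝕂 (TensorBundle 𝕂 V W x) := inferInstanceAs (Module 𝕂 (V x ⊗[𝕂] W x))

/-- The fibers carry their topology as finite-dimensional vector spaces. -/
instance : TopologicalSpace (TensorBundle 𝕂 V W x) := moduleTopology 𝕂 _
instance : IsModuleTopology 𝕂 (TensorBundle 𝕂 V W x) := ⟨rfl⟩

/-- The canonical bilinear map `(v, w) ↦ v ⊗ w` into the fiber over `x`. -/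
def TensorBundle.mk : V x →ₗ[𝕂] W x →ₗ[𝕂] TensorBundle 𝕂 V W x := TensorProduct.mk 𝕂 (V x) (W x)

variable [∀ x, Module ℝ (V x)] [∀ x, IsScalarTower ℝ 𝕂 (V x)]
instance : Module ℝ (TensorBundle 𝕂 V W x) := inferInstanceAs (Module ℝ (V x ⊗[𝕂] W x))
instance : IsScalarTower ℝ 𝕂 (TensorBundle 𝕂 V W x) :=
  inferInstanceAs (IsScalarTower ℝ 𝕂 (V x ⊗[𝕂] W x))

end fibers

variable [TopologicalSpace M]
  {F₁ : Type*} [NormedAddCommGroup F₁] [NormedSpace 𝕂 F₁] [FiniteDimensional 𝕂 F₁]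
  {V : M → Type*} [∀ x, AddCommGroup (V x)] [∀ x, Module 𝕂 (V x)]
  [TopologicalSpace (TotalSpace F₁ V)]
  {F₂ : Type*} [NormedAddCommGroup F₂] [NormedSpace 𝕂 F₂] [FiniteDimensional 𝕂 F₂]
  {W : M → Type*} [∀ x, AddCommGroup (W x)] [∀ x, Module 𝕂 (W x)]
  [TopologicalSpace (TotalSpace F₂ W)]

/-- Two trivializations `τ₁` of `V` and `τ₂` of `W` induce the trivialization
`t ↦ ((τ₁)ₓ ⊗ (τ₂)ₓ) t` of `V ⊗ W` over the intersection of their domains. -/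
def tensorPretrivialization (τ₁ : Trivialization F₁ (π F₁ V)) (τ₂ : Trivialization F₂ (π F₂ W))
    [τ₁.IsLinear 𝕂] [τ₂.IsLinear 𝕂] :
    Pretrivialization (TensorModel 𝕂 F₁ F₂) (π (TensorModel 𝕂 F₁ F₂) (TensorBundle 𝕂 V W)) where
  toFun p := ⟨p.1, TensorProduct.map (τ₁.linearMapAt 𝕂 p.1) (τ₂.linearMapAt 𝕂 p.1) p.2⟩
  invFun p := ⟨p.1, TensorProduct.map (τ₁.symmₗ 𝕂 p.1) (τ₂.symmₗ 𝕂 p.1) p.2⟩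
  source := TotalSpace.proj ⁻¹' (τ₁.baseSet ∩ τ₂.baseSet)
  target := (τ₁.baseSet ∩ τ₂.baseSet) ×ˢ univ
  map_source' := fun ⟨_, _⟩ h ↦ ⟨h, mem_univ _⟩
  map_target' := fun ⟨_, _⟩ h ↦ h.1
  left_inv' := fun ⟨x, t⟩ ⟨h₁, h₂⟩ ↦ by
    have e₁ : τ₁.symmₗ 𝕂 x ∘ₗ τ₁.linearMapAt 𝕂 x = LinearMap.id := by
      ext v; exact τ₁.symmₗ_linearMapAt h₁ v
    have e₂ : τ₂.symmₗ 𝕂 x ∘ₗ τ₂.linearMapAt 𝕂 x = LinearMap.id := by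
      ext v; exact τ₂.symmₗ_linearMapAt h₂ v
    refine congrArg (TotalSpace.mk x) ?_
    change TensorProduct.map (τ₁.symmₗ 𝕂 x) (τ₂.symmₗ 𝕂 x)
      (TensorProduct.map (τ₁.linearMapAt 𝕂 x) (τ₂.linearMapAt 𝕂 x) t) = t
    erw [← LinearMap.comp_apply, ← TensorProduct.map_comp, e₁, e₂, TensorProduct.map_id]
    rfl
  right_inv' := fun ⟨x, t⟩ ⟨⟨h₁, h₂⟩, _⟩ ↦ by
    have e₁ : τ₁.linearMapAt 𝕂 x ∘ₗ τ₁.symmₗ 𝕂 x = LinearMap.id := by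
      ext v; exact τ₁.linearMapAt_symmₗ h₁ v
    have e₂ : τ₂.linearMapAt 𝕂 x ∘ₗ τ₂.symmₗ 𝕂 x = LinearMap.id := by
      ext v; exact τ₂.linearMapAt_symmₗ h₂ v
    refine congrArg (Prod.mk x) ?_
    change TensorProduct.map (τ₁.linearMapAt 𝕂 x) (τ₂.linearMapAt 𝕂 x)
      (TensorProduct.map (τ₁.symmₗ 𝕂 x) (τ₂.symmₗ 𝕂 x) t) = t
    erw [← LinearMap.comp_apply, ← TensorProduct.map_comp, e₁, e₂, TensorProduct.map_id]
    rfl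
  open_target := (τ₁.open_baseSet.inter τ₂.open_baseSet).prod isOpen_univ
  baseSet := τ₁.baseSet ∩ τ₂.baseSet
  open_baseSet := τ₁.open_baseSet.inter τ₂.open_baseSet
  source_eq := rfl
  target_eq := rfl
  proj_toFun _ _ := rfl

instance (τ₁ : Trivialization F₁ (π F₁ V)) (τ₂ : Trivialization F₂ (π F₂ W))
    [τ₁.IsLinear 𝕂] [τ₂.IsLinear 𝕂] : (tensorPretrivialization 𝕂 τ₁ τ₂).IsLinear 𝕂 where
  linear x _ := (show V x ⊗[𝕂] W x →ₗ[𝕂] F₁ ⊗[𝕂] F₂ from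
    TensorProduct.map (τ₁.linearMapAt 𝕂 x) (τ₂.linearMapAt 𝕂 x)).isLinear

theorem tensorPretrivialization_symm (τ₁ : Trivialization F₁ (π F₁ V))
    (τ₂ : Trivialization F₂ (π F₂ W)) [τ₁.IsLinear 𝕂] [τ₂.IsLinear 𝕂] {x : M}
    (hx : x ∈ τ₁.baseSet ∩ τ₂.baseSet) (t : TensorModel 𝕂 F₁ F₂) :
    (tensorPretrivialization 𝕂 τ₁ τ₂).symm x t =
      TensorProduct.map (τ₁.symmₗ 𝕂 x) (τ₂.symmₗ 𝕂 x) t := by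
  rw [Pretrivialization.symm_apply _ hx]; rfl

variable [∀ x, TopologicalSpace (V x)] [FiberBundle F₁ V] [VectorBundle 𝕂 F₁ V]
  [∀ x, TopologicalSpace (W x)] [FiberBundle F₂ W] [VectorBundle 𝕂 F₂ W]

theorem tensor_coordChange (τ₁ τ₁' : Trivialization F₁ (π F₁ V))
    (τ₂ τ₂' : Trivialization F₂ (π F₂ W)) [τ₁.IsLinear 𝕂] [τ₂.IsLinear 𝕂]
    [τ₁'.IsLinear 𝕂] [τ₂'.IsLinear 𝕂] {x : M}
    (hx : x ∈ τ₁.baseSet ∩ τ₂.baseSet) (hx' : x ∈ τ₁'.baseSet ∩ τ₂'.baseSet)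
    (t : TensorModel 𝕂 F₁ F₂) :
    TensorModel.mapL 𝕂 F₁ F₂ (τ₁.coordChangeL 𝕂 τ₁' x) (τ₂.coordChangeL 𝕂 τ₂' x) t =
      (tensorPretrivialization 𝕂 τ₁' τ₂' ⟨x, (tensorPretrivialization 𝕂 τ₁ τ₂).symm x t⟩).2 := by
  have e₁ : τ₁'.linearMapAt 𝕂 x ∘ₗ τ₁.symmₗ 𝕂 x =
      (τ₁.coordChangeL 𝕂 τ₁' x : F₁ →L[𝕂] F₁).toLinearMap := by
    ext v
    simp [τ₁.coordChangeL_apply τ₁' ⟨hx.1, hx'.1⟩, hx'.1,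
      τ₁.symmₗ_apply hx.1]
  have e₂ : τ₂'.linearMapAt 𝕂 x ∘ₗ τ₂.symmₗ 𝕂 x =
      (τ₂.coordChangeL 𝕂 τ₂' x : F₂ →L[𝕂] F₂).toLinearMap := by
    ext v
    simp [τ₂.coordChangeL_apply τ₂' ⟨hx.2, hx'.2⟩, hx'.2,
      τ₂.symmₗ_apply hx.2]
  rw [tensorPretrivialization_symm 𝕂 τ₁ τ₂ hx]
  change TensorProduct.map _ _ t = TensorProduct.map (τ₁'.linearMapAt 𝕂 x) (τ₂'.linearMapAt 𝕂 x)
      (TensorProduct.map (τ₁.symmₗ 𝕂 x) (τ₂.symmₗ 𝕂 x) t)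
  erw [← LinearMap.comp_apply, ← TensorProduct.map_comp, e₁, e₂]

variable (F₁ V F₂ W) in
/-- The tensor product of two vector bundles, with the trivializations induced by those of the
two factors. -/
def tensorPrebundle : VectorPrebundle 𝕂 (TensorModel 𝕂 F₁ F₂) (TensorBundle 𝕂 V W) where
  pretrivializationAtlas :=
    {e | ∃ (τ₁ : Trivialization F₁ (π F₁ V)) (τ₂ : Trivialization F₂ (π F₂ W))
      (_ : MemTrivializationAtlas τ₁) (_ : MemTrivializationAtlas τ₂),
        e = tensorPretrivialization 𝕂 τ₁ τ₂}
  pretrivialization_linear' := by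
    rintro _ ⟨e₁, he₁, e₂, he₂, rfl⟩
    infer_instance
  pretrivializationAt x :=
    tensorPretrivialization 𝕂 (trivializationAt F₁ V x) (trivializationAt F₂ W x)
  mem_base_pretrivializationAt x :=
    ⟨mem_baseSet_trivializationAt F₁ V x, mem_baseSet_trivializationAt F₂ W x⟩
  pretrivialization_mem_atlas x :=
    ⟨trivializationAt F₁ V x, trivializationAt F₂ W x, inferInstance, inferInstance, rfl⟩
  exists_coordChange := by
    rintro _ ⟨τ₁, τ₂, h₁, h₂, rfl⟩ _ ⟨τ₁', τ₂', h₁', h₂', rfl⟩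
    refine ⟨fun x => TensorModel.mapL 𝕂 F₁ F₂ (τ₁.coordChangeL 𝕂 τ₁' x) (τ₂.coordChangeL 𝕂 τ₂' x),
      ?_, fun x hx t => tensor_coordChange 𝕂 τ₁ τ₁' τ₂ τ₂' hx.1 hx.2 t⟩
    have c₁ := continuousOn_coordChange 𝕂 τ₁ τ₁'
    have c₂ := continuousOn_coordChange 𝕂 τ₂ τ₂'
    refine ((TensorModel.mapL 𝕂 F₁ F₂).continuous.comp_continuousOn (c₁.mono ?_)).clm_apply
      (c₂.mono ?_)
    · exact fun x hx => ⟨hx.1.1, hx.2.1⟩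
    · exact fun x hx => ⟨hx.1.2, hx.2.2⟩
  totalSpaceMk_isInducing := by
    intro x
    have hx : x ∈ (tensorPretrivialization 𝕂 (trivializationAt F₁ V x)
        (trivializationAt F₂ W x)).baseSet :=
      ⟨mem_baseSet_trivializationAt F₁ V x, mem_baseSet_trivializationAt F₂ W x⟩
    let L : TensorBundle 𝕂 V W x ≃ₗ[𝕂] TensorModel 𝕂 F₁ F₂ :=
      (tensorPretrivialization 𝕂 (trivializationAt F₁ V x)
        (trivializationAt F₂ W x)).linearEquivAt 𝕂 x hx
    have : IsModuleTopology 𝕂 (TensorModel 𝕂 F₁ F₂) := isModuleTopologyOfFiniteDimensional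
    have : ContinuousAdd (TensorBundle 𝕂 V W x) := IsModuleTopology.toContinuousAdd 𝕂 _
    let L' : TensorBundle 𝕂 V W x ≃ₜ TensorModel 𝕂 F₁ F₂ :=
      { L.toEquiv with
        continuous_toFun := IsModuleTopology.continuous_of_linearMap L.toLinearMap
        continuous_invFun := IsModuleTopology.continuous_of_linearMap L.symm.toLinearMap }
    exact (isInducing_const_prod (x := x)).mpr L'.isInducing

instance : TopologicalSpace (TotalSpace (TensorModel 𝕂 F₁ F₂) (TensorBundle 𝕂 V W)) :=
  (tensorPrebundle 𝕂 F₁ V F₂ W).totalSpaceTopology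

instance : FiberBundle (TensorModel 𝕂 F₁ F₂) (TensorBundle 𝕂 V W) :=
  (tensorPrebundle 𝕂 F₁ V F₂ W).toFiberBundle

instance : VectorBundle 𝕂 (TensorModel 𝕂 F₁ F₂) (TensorBundle 𝕂 V W) :=
  (tensorPrebundle 𝕂 F₁ V F₂ W).toVectorBundle


end TensorBundle

section RealStructure

/-- A vector bundle over `𝕂` is a vector bundle over `ℝ`. -/
theorem vectorBundle_restrictScalars (𝕂 : Type*) [RCLike 𝕂] {M : Type*} [TopologicalSpace M]
    {F : Type*} [NormedAddCommGroup F] [NormedSpace 𝕂 F] [NormedSpace ℝ F] [IsScalarTower ℝ 𝕂 F]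
    {V : M → Type*} [∀ x, AddCommGroup (V x)] [∀ x, Module 𝕂 (V x)] [∀ x, Module ℝ (V x)]
    [∀ x, IsScalarTower ℝ 𝕂 (V x)]
    [TopologicalSpace (TotalSpace F V)] [∀ x, TopologicalSpace (V x)] [FiberBundle F V]
    [VectorBundle 𝕂 F V] : VectorBundle ℝ F V := by
  have hlin : ∀ (e : Trivialization F (π F V)) [MemTrivializationAtlas e], e.IsLinear ℝ := by
    intro e _
    refine ⟨fun b hb => ⟨(e.linear 𝕂 hb).1, fun c v => ?_⟩⟩
    rw [← algebraMap_smul 𝕂 c v, (e.linear 𝕂 hb).2, algebraMap_smul]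
  refine ⟨hlin, fun e e' _ _ => ?_⟩
  have h := (ContinuousLinearMap.restrictScalarsL 𝕂 F F ℝ ℝ).continuous.comp_continuousOn
    (continuousOn_coordChange 𝕂 e e')
  refine h.congr fun x hx => ?_
  ext v
  have := hlin e
  have := hlin e'
  simp [e.coordChangeL_apply e' hx]

theorem contMDiffOn_clm_of_apply {B : Type*} [NormedAddCommGroup B] [NormedSpace ℝ B]
    {M : Type*} [TopologicalSpace M] [ChartedSpace B M]
    {G : Type*} [NormedAddCommGroup G] [NormedSpace ℝ G] [FiniteDimensional ℝ G]
    {G' : Type*} [NormedAddCommGroup G'] [NormedSpace ℝ G'] {f : M → G →L[ℝ] G'} {s : Set M}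
    (h : ∀ v, ContMDiffOn 𝓘(ℝ, B) 𝓘(ℝ, G') ∞ (fun x => f x v) s) :
    ContMDiffOn 𝓘(ℝ, B) 𝓘(ℝ, G →L[ℝ] G') ∞ f s := by
  let b := Module.finBasis ℝ G
  have hf : f = fun x => ∑ i, ContinuousLinearMap.smulRightL ℝ G G'
      (LinearMap.toContinuousLinearMap (b.coord i)) (f x (b i)) := by
    funext x
    ext v
    have h' := congrArg (f x) (b.sum_repr v)
    rw [map_sum] at h'
    simp [← h']
  rw [hf]
  exact contMDiffOn_finsetSum fun i _ =>
    (ContinuousLinearMap.contMDiff _).comp_contMDiffOn (h (b i))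

variable (𝕂 : Type*) [RCLike 𝕂]
  {B : Type*} [NormedAddCommGroup B] [NormedSpace ℝ B]
  {M : Type*} [TopologicalSpace M] [ChartedSpace B M] [IsManifold 𝓘(ℝ, B) ∞ M]
  {F₁ : Type*} [NormedAddCommGroup F₁] [NormedSpace 𝕂 F₁] [NormedSpace ℝ F₁]
  [IsScalarTower ℝ 𝕂 F₁] [FiniteDimensional 𝕂 F₁]
  {V : M → Type*} [∀ x, AddCommGroup (V x)] [∀ x, Module 𝕂 (V x)] [∀ x, Module ℝ (V x)]
  [∀ x, IsScalarTower ℝ 𝕂 (V x)]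
  [TopologicalSpace (TotalSpace F₁ V)] [∀ x, TopologicalSpace (V x)] [FiberBundle F₁ V]
  [VectorBundle 𝕂 F₁ V] [VectorBundle ℝ F₁ V] [ContMDiffVectorBundle ∞ F₁ V 𝓘(ℝ, B)]
  {F₂ : Type*} [NormedAddCommGroup F₂] [NormedSpace 𝕂 F₂] [NormedSpace ℝ F₂]
  [IsScalarTower ℝ 𝕂 F₂] [FiniteDimensional 𝕂 F₂]
  {W : M → Type*} [∀ x, AddCommGroup (W x)] [∀ x, Module 𝕂 (W x)] [∀ x, Module ℝ (W x)]
  [∀ x, IsScalarTower ℝ 𝕂 (W x)]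
  [TopologicalSpace (TotalSpace F₂ W)] [∀ x, TopologicalSpace (W x)] [FiberBundle F₂ W]
  [VectorBundle 𝕂 F₂ W] [VectorBundle ℝ F₂ W] [ContMDiffVectorBundle ∞ F₂ W 𝓘(ℝ, B)]

instance : VectorBundle ℝ (TensorModel 𝕂 F₁ F₂) (TensorBundle 𝕂 V W) :=
  vectorBundle_restrictScalars 𝕂

theorem TensorModel.contDiff_mkL :
    ContDiff ℝ ∞ fun p : F₁ × F₂ => TensorModel.mkL 𝕂 F₁ F₂ p.1 p.2 :=
  (TensorModel.mkL 𝕂 F₁ F₂).isBoundedBilinearMap.contDiff.restrict_scalars ℝ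

/-- The tensor product of two smooth vector bundles is a smooth vector bundle. -/
instance : ContMDiffVectorBundle ∞ (TensorModel 𝕂 F₁ F₂) (TensorBundle 𝕂 V W) 𝓘(ℝ, B) where
  contMDiffOn_coordChangeL := by
    intro e e' he he'
    obtain ⟨_, ⟨τ₁, τ₂, h₁, h₂, rfl⟩, rfl⟩ := he.out
    obtain ⟨_, ⟨τ₁', τ₂', h₁', h₂', rfl⟩, rfl⟩ := he'.out
    refine contMDiffOn_clm_of_apply fun t => ?_
    have key : ContMDiffOn 𝓘(ℝ, B) 𝓘(ℝ, TensorModel 𝕂 F₁ F₂) ∞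
        (fun x => TensorModel.mapL 𝕂 F₁ F₂ (τ₁.coordChangeL 𝕂 τ₁' x) (τ₂.coordChangeL 𝕂 τ₂' x) t)
        ((τ₁.baseSet ∩ τ₂.baseSet) ∩ (τ₁'.baseSet ∩ τ₂'.baseSet)) := by
      induction t using TensorProduct.induction_on with
      | zero => exact contMDiffOn_const.congr fun x _ => map_zero _
      | add t t' ht ht' => exact (ht.add ht').congr fun x _ => map_add _ _ _
      | tmul v w =>
        have c₁ := (contMDiffOn_coordChangeL (n := ∞) (IB := 𝓘(ℝ, B)) τ₁ τ₁').clm_apply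
          (contMDiffOn_const (c := v))
        have c₂ := (contMDiffOn_coordChangeL (n := ∞) (IB := 𝓘(ℝ, B)) τ₂ τ₂').clm_apply
          (contMDiffOn_const (c := w))
        refine ((TensorModel.contDiff_mkL 𝕂).contMDiff.comp_contMDiffOn
          ((c₁.mono fun x hx => ⟨hx.1.1, hx.2.1⟩).prodMk_space
            (c₂.mono fun x hx => ⟨hx.1.2, hx.2.2⟩))).congr fun x hx => ?_
        have e₁ : τ₁.coordChangeL 𝕂 τ₁' x v = τ₁.coordChangeL ℝ τ₁' x v := by
          rw [τ₁.coordChangeL_apply τ₁' ⟨hx.1.1, hx.2.1⟩,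
            τ₁.coordChangeL_apply τ₁' ⟨hx.1.1, hx.2.1⟩]
        have e₂ : τ₂.coordChangeL 𝕂 τ₂' x w = τ₂.coordChangeL ℝ τ₂' x w := by
          rw [τ₂.coordChangeL_apply τ₂' ⟨hx.1.2, hx.2.2⟩,
            τ₂.coordChangeL_apply τ₂' ⟨hx.1.2, hx.2.2⟩]
        change (τ₁.coordChangeL 𝕂 τ₁' x v) ⊗ₜ[𝕂] (τ₂.coordChangeL 𝕂 τ₂' x w) =
          (τ₁.coordChangeL ℝ τ₁' x v) ⊗ₜ[𝕂] (τ₂.coordChangeL ℝ τ₂' x w)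
        rw [e₁, e₂]
    refine key.congr fun x hx => ?_
    rw [tensor_coordChange 𝕂 τ₁ τ₁' τ₂ τ₂' hx.1 hx.2]
    exact Trivialization.coordChangeL_apply _ _ hx t

/-- The pointwise tensor product `x ↦ s x ⊗ t x` of two smooth sections. -/
def sectionTensor (s : Cₛ^∞⟮𝓘(ℝ, B); F₁, V⟯) (t : Cₛ^∞⟮𝓘(ℝ, B); F₂, W⟯) :
    Cₛ^∞⟮𝓘(ℝ, B); TensorModel 𝕂 F₁ F₂, TensorBundle 𝕂 V W⟯ where
  toFun x := TensorBundle.mk 𝕂 V W x (s x) (t x)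
  contMDiff_toFun := by
    intro x₀
    have hs := s.contMDiff x₀
    have ht := t.contMDiff x₀
    rw [contMDiffAt_section] at hs ht ⊢
    refine ((TensorModel.contDiff_mkL 𝕂).contMDiff.contMDiffAt.comp x₀
      (hs.prodMk_space ht)).congr_of_eventuallyEq ?_
    filter_upwards [(trivializationAt F₁ V x₀).open_baseSet.mem_nhds
        (mem_baseSet_trivializationAt F₁ V x₀), (trivializationAt F₂ W x₀).open_baseSet.mem_nhds
        (mem_baseSet_trivializationAt F₂ W x₀)] with x h₁ h₂
    change ((trivializationAt F₁ V x₀).linearMapAt 𝕂 x (s x)) ⊗ₜ[𝕂]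
      ((trivializationAt F₂ W x₀).linearMapAt 𝕂 x (t x)) = _
    rw [(trivializationAt F₁ V x₀).linearMapAt_apply, (trivializationAt F₂ W x₀).linearMapAt_apply,
      if_pos h₁, if_pos h₂]
    rfl

variable (B F₁ V F₂ W) in
/-- The canonical `C^∞(M)`-linear map `Γ(V) ⊗_{C^∞(M)} Γ(W) → Γ(V ⊗ W)`, which sends `s ⊗ t`
to the section `x ↦ s x ⊗ t x`. -/
def sectionTensorMap :
    Cₛ^∞⟮𝓘(ℝ, B); F₁, V⟯ ⊗[C^∞⟮𝓘(ℝ, B), M; 𝓘(ℝ, 𝕂), 𝕂⟯] Cₛ^∞⟮𝓘(ℝ, B); F₂, W⟯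
      →ₗ[C^∞⟮𝓘(ℝ, B), M; 𝓘(ℝ, 𝕂), 𝕂⟯]
        Cₛ^∞⟮𝓘(ℝ, B); TensorModel 𝕂 F₁ F₂, TensorBundle 𝕂 V W⟯ :=
  TensorProduct.lift <| LinearMap.mk₂ C^∞⟮𝓘(ℝ, B), M; 𝓘(ℝ, 𝕂), 𝕂⟯ (sectionTensor 𝕂)
    (fun s s' t => by ext x; exact TensorProduct.add_tmul (s x) (s' x) (t x))
    (fun f s t => by ext x; exact TensorProduct.smul_tmul' (f x) (s x) (t x))
    (fun s t t' => by ext x; exact TensorProduct.tmul_add (s x) (t x) (t' x))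
    (fun f s t => by ext x; exact TensorProduct.tmul_smul (f x) (s x) (t x))

theorem sectionTensorMap_tmul_apply (s : Cₛ^∞⟮𝓘(ℝ, B); F₁, V⟯) (t : Cₛ^∞⟮𝓘(ℝ, B); F₂, W⟯)
    (x : M) : sectionTensorMap 𝕂 B F₁ V F₂ W (s ⊗ₜ t) x =
      TensorBundle.mk 𝕂 V W x (s x) (t x) := rfl

end RealStructure

end

/-! The theorem rests on a finite dual basis for `Γ(F)`: global sections `t_k` and smooth families
of functionals `d_k` on the fibers, `k < m`, with `∑ d_k(v) t_k(x) = v` for every `v` in the fiber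
over `x` (`exists_dual_basis_sections`). Given these, the inverse of `s ⊗ u ↦ (x ↦ s x ⊗ u x)` is
explicit: `ζ ↦ ∑ (id ⊗ d_k)(ζ) ⊗ t_k`. On a pure tensor the contraction gives `d_k(u) s`; moving the
function `d_k(u)` across the balanced tensor sign leaves `s ⊗ ∑ d_k(u) t_k = s ⊗ u`. The other
composition is the same identity, fiber by fiber. Nothing of this kind is needed for `E`.

For the topology, `(s, u) ↦ s ⊗ u` is continuous into `Γ(E ⊗ F)` by the Leibniz rule
(`continuous_sectionTensor`), so the map out of the projective tensor product is continuous and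
kills the closure `J`. Contraction with `d_k` is an operator of order zero with smooth coefficients,
hence continuous (`continuous_contractSection`), so the explicit inverse is continuous as well,
already into the tensor product before the quotient.

Since `M` need not be compact, the finiteness of the dual basis is the geometric point. Over a
compact set finitely many sections generate, but their number could grow with the set. A dimension
count bounds it by the dimension `N` of the total space of the dual bundle
(`GeneratesOn.exists_drop`). The shells of a compact exhaustion fall into three classes of pairwise
disjoint sets, and `3N` sections generate globally (`exists_finite_generatesOn_univ`). Functionals
are then built locally by inverting a matrix and glued by a partition of unity. -/

noncomputable section

/-! ### Leibniz estimates at a point. -/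

section Calculus

variable {D E F G : Type*} [NormedAddCommGroup D] [NormedSpace ℝ D]
  [NormedAddCommGroup E] [NormedSpace ℝ E] [NormedAddCommGroup F] [NormedSpace ℝ F]
  [NormedAddCommGroup G] [NormedSpace ℝ G]

/-- The Leibniz estimate for iterated derivatives of a bilinear expression, at a point. -/
theorem ContDiffAt.norm_iteratedFDeriv_le_of_bilinear (β : E →L[ℝ] F →L[ℝ] G) {f : D → E}
    {g : D → F} {x : D} {n : ℕ} (hf : ContDiffAt ℝ n f x) (hg : ContDiffAt ℝ n g x) :
    ‖iteratedFDeriv ℝ n (fun y => β (f y) (g y)) x‖ ≤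
      ‖β‖ * ∑ i ∈ Finset.range (n + 1), (n.choose i : ℝ) * ‖iteratedFDeriv ℝ i f x‖ *
        ‖iteratedFDeriv ℝ (n - i) g x‖ := by
  -- On a common open neighborhood where both factors are `C^n`, derivatives within the set agree
  -- with the ordinary ones, so the estimate for functions on sets applies.
  obtain ⟨u, hu, hfu⟩ := hf.contDiffOn le_rfl (by simp)
  obtain ⟨v, hv, hgv⟩ := hg.contDiffOn le_rfl (by simp)
  obtain ⟨o, ho, hoo, hxo⟩ := mem_nhds_iff.1 (Filter.inter_mem hu hv)
  have h := β.norm_iteratedFDerivWithin_le_of_bilinear (hfu.mono fun y hy => (ho hy).1)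
    (hgv.mono fun y hy => (ho hy).2) hoo.uniqueDiffOn hxo le_rfl
  simpa only [iteratedFDerivWithin_of_isOpen _ hoo hxo] using h

/-- The Leibniz estimate, with bounds for the derivatives of both factors up to a given order. -/
theorem ContDiffAt.norm_iteratedFDeriv_bilinear_le_mul (β : E →L[ℝ] F →L[ℝ] G) {f : D → E}
    {g : D → F} {x : D} {n : ℕ} (hf : ContDiffAt ℝ n f x) (hg : ContDiffAt ℝ n g x) {a b : ℝ}
    (ha : ∀ j ≤ n, ‖iteratedFDeriv ℝ j f x‖ ≤ a) (hb : ∀ j ≤ n, ‖iteratedFDeriv ℝ j g x‖ ≤ b) :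
    ‖iteratedFDeriv ℝ n (fun y => β (f y) (g y)) x‖ ≤ ‖β‖ * 2 ^ n * (a * b) := by
  have ha0 : 0 ≤ a := (norm_nonneg _).trans (ha 0 n.zero_le)
  refine (hf.norm_iteratedFDeriv_le_of_bilinear β hg).trans ?_
  rw [mul_assoc]
  gcongr
  have h2 : (2 : ℝ) ^ n = ∑ i ∈ Finset.range (n + 1), (n.choose i : ℝ) := by
    exact_mod_cast (Nat.sum_range_choose n).symm
  rw [h2, Finset.sum_mul]
  refine Finset.sum_le_sum fun i hi => ?_
  rw [mul_assoc]
  gcongr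
  · exact ha i (Nat.lt_succ_iff.1 (Finset.mem_range.1 hi))
  · exact hb _ (Nat.sub_le _ _)

end Calculus

/-! ### Seminorms on sections and criteria for continuity. -/

section SectionTopology

variable {B : Type*} [NormedAddCommGroup B] [NormedSpace ℝ B]
  {M : Type*} [TopologicalSpace M] [ChartedSpace B M] [IsManifold 𝓘(ℝ, B) ∞ M]
  {F : Type*} [NormedAddCommGroup F] [NormedSpace ℝ F]
  {V : M → Type*} [∀ x, AddCommGroup (V x)] [∀ x, Module ℝ (V x)]
  [TopologicalSpace (TotalSpace F V)] [∀ x, TopologicalSpace (V x)] [FiberBundle F V]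
  [VectorBundle ℝ F V] [ContMDiffVectorBundle ∞ F V 𝓘(ℝ, B)]

instance instIsTopologicalAddGroupSections : IsTopologicalAddGroup Cₛ^∞⟮𝓘(ℝ, B); F, V⟯ :=
  (withSeminorms_sections (B := B) (F := F) (V := V)).topologicalAddGroup

instance instLocallyConvexSpaceSections : LocallyConvexSpace ℝ Cₛ^∞⟮𝓘(ℝ, B); F, V⟯ :=
  (withSeminorms_sections (B := B) (F := F) (V := V)).toLocallyConvexSpace

theorem continuous_sectionSeminorm (i : SeminormIndex F V (B := B)) :
    Continuous (sectionSeminorm i) :=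
  (withSeminorms_sections (B := B) (F := F) (V := V)).continuous_seminorm i

theorem norm_iteratedFDeriv_localRep_le_sectionSeminorm (i : SeminormIndex F V (B := B))
    (s : Cₛ^∞⟮𝓘(ℝ, B); F, V⟯) {x : M} (hx : x ∈ i.K) :
    ‖iteratedFDeriv ℝ i.order (localRep i.chart i.triv s) (i.chart x)‖ ≤ sectionSeminorm i s :=
  le_ciSup (bddAbove_localRep i s) ⟨x, hx⟩

theorem sectionSeminorm_le (i : SeminormIndex F V (B := B)) (s : Cₛ^∞⟮𝓘(ℝ, B); F, V⟯) {C : ℝ}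
    (hC : 0 ≤ C)
    (h : ∀ x ∈ i.K, ‖iteratedFDeriv ℝ i.order (localRep i.chart i.triv s) (i.chart x)‖ ≤ C) :
    sectionSeminorm i s ≤ C :=
  Real.iSup_le (fun x => h x x.2) hC

/-- Seminorms of order zero over one-point sets already separate sections. The point of this is that
kernels of continuous maps into sections are closed, hence contain the closure `J` as soon as they
contain its generators. -/
instance instT1SpaceSections : T1Space Cₛ^∞⟮𝓘(ℝ, B); F, V⟯ := by
  refine (withSeminorms_sections (B := B) (F := F) (V := V)).T1_of_separating fun s hs => ?_
  contrapose! hs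
  ext x
  let φ := chartAt B x
  let τ := trivializationAt F V x
  have hx : x ∈ φ.source ∩ τ.baseSet := ⟨mem_chart_source B x, mem_baseSet_trivializationAt F V x⟩
  let i : SeminormIndex F V (B := B) := ⟨φ, chart_mem_atlas B x, τ, trivialization_mem_atlas F V x,
    {x}, isCompact_singleton, by simpa using hx, 0⟩
  have h := norm_iteratedFDeriv_localRep_le_sectionSeminorm i s (mem_singleton x)
  have h0 : sectionSeminorm i s = 0 := hs i
  rw [h0, norm_iteratedFDeriv_zero, norm_le_zero_iff] at h
  have h' : (τ ⟨x, s x⟩).2 = 0 := by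
    change (τ ⟨φ.symm (φ x), s (φ.symm (φ x))⟩).2 = 0 at h
    rwa [φ.left_inv hx.1] at h
  have := (τ.linearEquivAt ℝ x hx.2).map_eq_zero_iff (x := s x)
  exact this.1 h'

/-- Near each point of the domain of a chart and a trivialization, the derivatives of local
representations up to a given order are bounded by a continuous seminorm. -/
theorem exists_seminorm_iteratedFDeriv_localRep_le [LocallyCompactSpace M]
    {φ : OpenPartialHomeomorph M B} (hφ : φ ∈ atlas B M)
    {τ : Trivialization F (π F V)} (hτ : τ ∈ trivializationAtlas F V) {x : M}
    (hx : x ∈ φ.source ∩ τ.baseSet) (k : ℕ) :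
    ∃ U ∈ 𝓝 x, U ⊆ φ.source ∩ τ.baseSet ∧ ∃ p : Seminorm ℝ Cₛ^∞⟮𝓘(ℝ, B); F, V⟯, Continuous p ∧
      ∀ s : Cₛ^∞⟮𝓘(ℝ, B); F, V⟯, ∀ y ∈ U, ∀ j ≤ k,
        ‖iteratedFDeriv ℝ j (localRep φ τ s) (φ y)‖ ≤ p s := by
  obtain ⟨K, hK, hKs, hKc⟩ := local_compact_nhds
    ((φ.open_source.inter τ.open_baseSet).mem_nhds hx)
  -- A seminorm index carries exactly one order of differentiation, so all orders up to `k` are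
  -- collected in a sum.
  let i (j : ℕ) : SeminormIndex F V (B := B) := ⟨φ, hφ, τ, hτ, K, hKc, hKs, j⟩
  refine ⟨K, hK, hKs, ∑ j ∈ Finset.range (k + 1), sectionSeminorm (i j), ?_, fun s y hy j hj => ?_⟩
  · refine (continuous_finsetSum (Finset.range (k + 1))
      fun j _ => continuous_sectionSeminorm (i j)).congr fun s => ?_
    rw [FunLike.coe_sum, Finset.sum_apply]
  · rw [FunLike.coe_sum, Finset.sum_apply]
    refine (norm_iteratedFDeriv_localRep_le_sectionSeminorm (i j) s hy).trans ?_
    exact Finset.single_le_sum (f := fun j => sectionSeminorm (i j) s)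
      (fun j _ => apply_nonneg _ _) (Finset.mem_range.2 (Nat.lt_succ_of_le hj))

/-- A bilinear map into a space of sections is continuous if its local representations are
bounded by products of continuous seminorms, locally on the base. -/
theorem continuous_bilinear_of_localRep_le {G G' : Type*} [AddCommGroup G] [Module ℝ G]
    [TopologicalSpace G] [IsTopologicalAddGroup G] [AddCommGroup G'] [Module ℝ G']
    [TopologicalSpace G'] [IsTopologicalAddGroup G']
    (T : G →ₗ[ℝ] G' →ₗ[ℝ] Cₛ^∞⟮𝓘(ℝ, B); F, V⟯)
    (h : ∀ φ ∈ atlas B M, ∀ τ ∈ trivializationAtlas F V, ∀ x ∈ φ.source ∩ τ.baseSet, ∀ k : ℕ,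
      ∃ U ∈ 𝓝 x, ∃ (p : Seminorm ℝ G) (q : Seminorm ℝ G'), Continuous p ∧ Continuous q ∧
        ∀ g g', ∀ y ∈ U, ‖iteratedFDeriv ℝ k (localRep φ τ (T g g')) (φ y)‖ ≤ p g * q g') :
    Continuous fun z : G × G' => T z.1 z.2 := by
  have key (i : SeminormIndex F V (B := B)) :
      ∃ (p : Seminorm ℝ G) (q : Seminorm ℝ G'), Continuous p ∧ Continuous q ∧
        ∀ g g', sectionSeminorm i (T g g') ≤ p g * q g' := by
    have : ∃ (p : Seminorm ℝ G) (q : Seminorm ℝ G'), Continuous p ∧ Continuous q ∧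
        ∀ g g', ∀ y ∈ i.K,
          ‖iteratedFDeriv ℝ i.order (localRep i.chart i.triv (T g g')) (i.chart y)‖ ≤
            p g * q g' := by
      refine i.isCompact_K.induction_on ?_ ?_ ?_ ?_
      · exact ⟨0, 0, continuous_zero, continuous_zero, by simp⟩
      · rintro s t hst ⟨p, q, hp, hq, H⟩
        exact ⟨p, q, hp, hq, fun g g' y hy => H g g' y (hst hy)⟩
      · rintro s t ⟨p, q, hp, hq, H⟩ ⟨p', q', hp', hq', H'⟩
        -- The product `(p + p') * (q + q')` dominates both `p * q` and `p' * q'`, which allows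
        -- finitely many local bounds to be merged over a compact set.
        refine ⟨p + p', q + q', hp.add hp', hq.add hq', fun g g' y hy => ?_⟩
        have h1 := mul_nonneg (apply_nonneg p g) (apply_nonneg q' g')
        have h2 := mul_nonneg (apply_nonneg p' g) (apply_nonneg q g')
        have h3 := mul_nonneg (apply_nonneg p g) (apply_nonneg q g')
        have h4 := mul_nonneg (apply_nonneg p' g) (apply_nonneg q' g')
        rw [add_apply, add_apply]
        rcases hy with hy | hy
        · linarith [H g g' y hy]
        · linarith [H' g g' y hy]
      · intro x hx
        obtain ⟨U, hU, p, q, hp, hq, H⟩ :=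
          h i.chart i.chart_mem i.triv i.triv_mem x (i.K_subset hx) i.order
        exact ⟨U, mem_nhdsWithin_of_mem_nhds hU, p, q, hp, hq, H⟩
    obtain ⟨p, q, hp, hq, H⟩ := this
    exact ⟨p, q, hp, hq, fun g g' => sectionSeminorm_le i _
      (mul_nonneg (apply_nonneg _ _) (apply_nonneg _ _)) (H g g')⟩
  rw [continuous_iff_continuousAt]
  rintro ⟨g₀, g₀'⟩
  refine ((withSeminorms_sections (B := B) (F := F) (V := V)).tendsto_nhds _ _).2 fun i ε hε => ?_
  obtain ⟨p, q, hp, hq, H⟩ := key i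
  have hc : Continuous fun z : G × G' => p (z.1 - g₀) * q z.2 + p g₀ * q (z.2 - g₀') := by
    fun_prop
  have h0 : p (g₀ - g₀) * q g₀' + p g₀ * q (g₀' - g₀') = 0 := by simp
  filter_upwards [hc.continuousAt.eventually_lt (continuousAt_const (y := ε))
    (x₀ := (g₀, g₀')) (by simpa [h0] using hε)] with z hz
  have e : T z.1 z.2 - T g₀ g₀' = T (z.1 - g₀) z.2 + T g₀ (z.2 - g₀') := by
    simp only [map_sub, LinearMap.sub_apply]; abel
  rw [e]
  exact ((map_add_le_add (sectionSeminorm i) _ _).trans (add_le_add (H _ _) (H _ _))).trans_lt hz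

/-- A linear map into a space of sections is continuous if its local representations are bounded
by continuous seminorms, locally on the base. -/
theorem continuous_of_localRep_le {G : Type*} [AddCommGroup G] [Module ℝ G]
    [TopologicalSpace G] [IsTopologicalAddGroup G] (T : G →ₗ[ℝ] Cₛ^∞⟮𝓘(ℝ, B); F, V⟯)
    (h : ∀ φ ∈ atlas B M, ∀ τ ∈ trivializationAtlas F V, ∀ x ∈ φ.source ∩ τ.baseSet, ∀ k : ℕ,
      ∃ U ∈ 𝓝 x, ∃ p : Seminorm ℝ G, Continuous p ∧
        ∀ g, ∀ y ∈ U, ‖iteratedFDeriv ℝ k (localRep φ τ (T g)) (φ y)‖ ≤ p g) :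
    Continuous T := by
  -- The linear case is the bilinear one for `(g, c) ↦ c • T g` with real `c`, restricted to `c =
  -- 1`.
  have hc := continuous_bilinear_of_localRep_le ((LinearMap.lsmul ℝ _).flip ∘ₗ T) (G' := ℝ)
    fun φ hφ τ hτ x hx k => by
      obtain ⟨U, hU, p, hp, H⟩ := h φ hφ τ hτ x hx k
      refine ⟨U, hU, p, normSeminorm ℝ ℝ, hp, continuous_norm, fun g c y hy => ?_⟩
      have e : ((LinearMap.lsmul ℝ _).flip ∘ₗ T) g c = T (c • g) := by simp
      rw [e, mul_comm]
      simpa [map_smul_eq_mul] using H (c • g) y hy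
  simpa [Function.comp_def] using hc.comp (Continuous.prodMk_left (1 : ℝ))

end SectionTopology

/-! ### Continuity of scalar multiplication over `𝕂`. -/

section ScalarMultiplication

variable {𝕂 : Type*} [RCLike 𝕂] {B : Type*} [NormedAddCommGroup B] [NormedSpace ℝ B]
  {M : Type*} [TopologicalSpace M] [ChartedSpace B M] [IsManifold 𝓘(ℝ, B) ∞ M]
  {F : Type*} [NormedAddCommGroup F] [NormedSpace 𝕂 F] [NormedSpace ℝ F] [IsScalarTower ℝ 𝕂 F]
  {V : M → Type*} [∀ x, AddCommGroup (V x)] [∀ x, Module 𝕂 (V x)] [∀ x, Module ℝ (V x)]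
  [∀ x, IsScalarTower ℝ 𝕂 (V x)]
  [TopologicalSpace (TotalSpace F V)] [∀ x, TopologicalSpace (V x)] [FiberBundle F V]
  [VectorBundle 𝕂 F V] [VectorBundle ℝ F V] [ContMDiffVectorBundle ∞ F V 𝓘(ℝ, B)]

/-- The seminorms are real seminorms by construction; this supplies the homogeneity for scalars in
`𝕂`, which holds because the trivializations are `𝕂`-linear. -/
theorem sectionSeminorm_rclike_smul_le (i : SeminormIndex F V (B := B)) (c : 𝕂)
    (s : Cₛ^∞⟮𝓘(ℝ, B); F, V⟯) : sectionSeminorm i (c • s) ≤ ‖c‖ * sectionSeminorm i s := by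
  have : MemTrivializationAtlas i.triv := ⟨i.triv_mem⟩
  refine sectionSeminorm_le i _ (mul_nonneg (norm_nonneg _) (apply_nonneg _ _)) fun x hx => ?_
  have hx' := i.K_subset hx
  have hs := (contDiffAt_localRep i.chart_mem i.triv_mem s hx').of_le
    (m := i.order) (by exact_mod_cast le_top)
  have heq : localRep i.chart i.triv ⇑(c • s : Cₛ^∞⟮𝓘(ℝ, B); F, V⟯) =ᶠ[𝓝 (i.chart x)]
      c • localRep i.chart i.triv s := by
    filter_upwards [localRep_domain_mem_nhds i.chart i.triv hx'] with y hy
    exact (i.triv.linear 𝕂 hy.2).2 _ _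
  rw [(heq.iteratedFDeriv ℝ i.order).eq_of_nhds, iteratedFDeriv_const_smul_apply hs]
  refine (norm_smul_le _ _).trans ?_
  gcongr
  exact norm_iteratedFDeriv_localRep_le_sectionSeminorm i s hx

/-- The space of sections is a topological vector space over `𝕂`. -/
theorem continuousSMul_rclike_sections : ContinuousSMul 𝕂 Cₛ^∞⟮𝓘(ℝ, B); F, V⟯ := by
  refine ⟨continuous_iff_continuousAt.2 ?_⟩
  rintro ⟨c₀, s₀⟩
  refine ((withSeminorms_sections (B := B) (F := F) (V := V)).tendsto_nhds _ _).2 fun i ε hε => ?_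
  have hp := continuous_sectionSeminorm i
  have hc : Continuous fun z : 𝕂 × Cₛ^∞⟮𝓘(ℝ, B); F, V⟯ =>
      ‖z.1‖ * sectionSeminorm i (z.2 - s₀) + ‖z.1 - c₀‖ * sectionSeminorm i s₀ := by
    fun_prop
  filter_upwards [hc.continuousAt.eventually_lt (continuousAt_const (y := ε))
    (x₀ := (c₀, s₀)) (by simpa using hε)] with z hz
  have e : z.1 • z.2 - c₀ • s₀ = z.1 • (z.2 - s₀) + (z.1 - c₀) • s₀ := by
    rw [smul_sub, sub_smul]; abel
  rw [e]
  exact ((map_add_le_add (sectionSeminorm i) _ _).trans (add_le_add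
    (sectionSeminorm_rclike_smul_le i _ _) (sectionSeminorm_rclike_smul_le i _ _))).trans_lt hz

end ScalarMultiplication

end

noncomputable section

/-! ### Finitely many global sections generate a bundle. -/

section LocalRep

variable {B : Type*} [NormedAddCommGroup B] {M : Type*} [TopologicalSpace M]
  {F : Type*} [NormedAddCommGroup F] {V : M → Type*} [TopologicalSpace (TotalSpace F V)]

theorem localRep_apply_chart (φ : OpenPartialHomeomorph M B) (τ : Trivialization F (π F V))
    (s : ∀ x, V x) {x : M} (hx : x ∈ φ.source) : localRep φ τ s (φ x) = (τ ⟨x, s x⟩).2 := by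
  rw [localRep, φ.left_inv hx]

end LocalRep

section GeneratingSections

variable {B : Type*} [NormedAddCommGroup B] [NormedSpace ℝ B] [FiniteDimensional ℝ B]
  {M : Type*} [TopologicalSpace M] [ChartedSpace B M] [IsManifold 𝓘(ℝ, B) ∞ M]
  {F : Type*} [NormedAddCommGroup F] [NormedSpace ℝ F] [FiniteDimensional ℝ F]
  {V : M → Type*} [∀ x, AddCommGroup (V x)] [∀ x, Module ℝ (V x)]
  [TopologicalSpace (TotalSpace F V)] [∀ x, TopologicalSpace (V x)] [FiberBundle F V]
  [VectorBundle ℝ F V] [ContMDiffVectorBundle ∞ F V 𝓘(ℝ, B)]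

/-- A family of sections generates the bundle over a set if its values span the fibers there. -/
def GeneratesOn {ι : Type*} (t : ι → Cₛ^∞⟮𝓘(ℝ, B); F, V⟯) (K : Set M) : Prop :=
  ∀ x ∈ K, Submodule.span ℝ (range fun i => t i x) = ⊤

theorem GeneratesOn.of_range_subset {ι κ : Type*} {t : ι → Cₛ^∞⟮𝓘(ℝ, B); F, V⟯}
    {t' : κ → Cₛ^∞⟮𝓘(ℝ, B); F, V⟯} {K : Set M} (h : GeneratesOn t K)
    (htt' : ∀ x ∈ K, ∀ i, t i x ∈ Submodule.span ℝ (range fun j => t' j x)) :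
    GeneratesOn t' K := by
  intro x hx
  rw [eq_top_iff, ← h x hx, Submodule.span_le]
  rintro _ ⟨i, rfl⟩
  exact htt' x hx i

/-- The vectors of values of a covector on finitely many given sections form a set whose
dimension is at most the dimension of the total space of the dual bundle. -/
theorem dimH_covector_values_le [SecondCountableTopology M] {m : ℕ}
    (t : Fin m → Cₛ^∞⟮𝓘(ℝ, B); F, V⟯) :
    dimH {ℓ : Fin m → ℝ | ∃ (x : M) (ξ : V x →ₗ[ℝ] ℝ), ℓ = fun i => ξ (t i x)} ≤
      finrank ℝ (B × (F →L[ℝ] ℝ)) := by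
  let U (x : M) : Set M := (chartAt B x).source ∩ (trivializationAt F V x).baseSet
  have hU (x : M) : U x ∈ 𝓝 x :=
    ((chartAt B x).open_source.inter (trivializationAt F V x).open_baseSet).mem_nhds
      ⟨mem_chart_source B x, mem_baseSet_trivializationAt F V x⟩
  obtain ⟨c, hc, hcU⟩ := TopologicalSpace.countable_cover_nhds hU
  let S (x : M) : Set (B × (F →L[ℝ] ℝ)) := {z | z.1 ∈ chartAt B x '' U x}
  -- In a chart and a trivialization, covectors are parametrized by `B × F*`, and the vector of
  -- values is a `C^1` function of this parameter. Such maps are locally Lipschitz and do not raise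
  -- Hausdorff dimension; second countability reduces to countably many domains.
  let g (x : M) (z : B × (F →L[ℝ] ℝ)) : Fin m → ℝ := fun i =>
    z.2 (localRep (chartAt B x) (trivializationAt F V x) (t i) z.1)
  have hsub : {ℓ : Fin m → ℝ | ∃ (x : M) (ξ : V x →ₗ[ℝ] ℝ), ℓ = fun i => ξ (t i x)} ⊆
      ⋃ x ∈ c, g x '' S x := by
    rintro _ ⟨y, ξ, rfl⟩
    obtain ⟨x, hxc, hy⟩ := mem_iUnion₂.1 (hcU.symm ▸ mem_univ y : y ∈ ⋃ x ∈ c, U x)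
    refine mem_iUnion₂.2 ⟨x, hxc, ⟨chartAt B x y, LinearMap.toContinuousLinearMap
      (ξ ∘ₗ (trivializationAt F V x).symmₗ ℝ y)⟩, ⟨y, hy, rfl⟩, ?_⟩
    funext i
    simp only [g, localRep_apply_chart _ _ _ hy.1, LinearMap.coe_toContinuousLinearMap',
      LinearMap.comp_apply]
    congr 1
    have := (trivializationAt F V x).symmₗ_linearMapAt (R := ℝ) hy.2 (t i y)
    rwa [(trivializationAt F V x).linearMapAt_apply, if_pos hy.2] at this
  refine (dimH_mono hsub).trans ?_
  rw [dimH_bUnion hc]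
  refine iSup₂_le fun x _ => ?_
  refine (dimH_image_le_of_locally_lipschitzOn ?_).trans
    ((dimH_mono (subset_univ _)).trans_eq (Real.dimH_univ_eq_finrank _))
  rintro ⟨_, η⟩ ⟨y, hy, rfl⟩
  have hg : ContDiffAt ℝ 1 (g x) (chartAt B x y, η) := by
    refine contDiffAt_pi.2 fun i => ?_
    have h1 : ContDiffAt ℝ 1 (localRep (chartAt B x) (trivializationAt F V x) (t i))
        (chartAt B x y) :=
      (contDiffAt_localRep (chart_mem_atlas B x) (trivialization_mem_atlas F V x) (t i) hy).of_le
        (by simp)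
    have h2 : ContDiffAt ℝ 1 (fun z : B × (F →L[ℝ] ℝ) =>
        localRep (chartAt B x) (trivializationAt F V x) (t i) z.1) (chartAt B x y, η) :=
      ContDiffAt.comp (g := localRep (chartAt B x) (trivializationAt F V x) (t i))
        (f := Prod.fst) (chartAt B x y, η) h1 contDiffAt_fst
    exact contDiffAt_snd.clm_apply h2
  obtain ⟨C, s, hs, hL⟩ := hg.exists_lipschitzOnWith
  exact ⟨C, s, mem_nhdsWithin_of_mem_nhds hs, hL⟩

/-- A generating family with more members than the dimension of the total space of the dual
bundle can be replaced by one with one member less. -/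
theorem GeneratesOn.exists_drop [SecondCountableTopology M] {m : ℕ}
    (hm : finrank ℝ (B × (F →L[ℝ] ℝ)) ≤ m) {t : Fin (m + 1) → Cₛ^∞⟮𝓘(ℝ, B); F, V⟯} {K : Set M}
    (ht : GeneratesOn t K) : ∃ t' : Fin m → Cₛ^∞⟮𝓘(ℝ, B); F, V⟯, GeneratesOn t' K := by
  -- If every vector occurred as a vector of covector values, all of `ℝ^(m+1)` would have dimension
  -- at most `m`.
  obtain ⟨ℓ, hℓ⟩ : ∃ ℓ : Fin (m + 1) → ℝ,
      ¬ ∃ (x : M) (ξ : V x →ₗ[ℝ] ℝ), ℓ = fun i => ξ (t i x) := by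
    by_contra! h
    have h1 := dimH_covector_values_le t
    rw [show {ℓ : Fin (m + 1) → ℝ | ∃ (x : M) (ξ : V x →ₗ[ℝ] ℝ), ℓ = fun i => ξ (t i x)} = univ
      from eq_univ_of_forall h, Real.dimH_univ_eq_finrank, finrank_fin_fun] at h1
    have h2 : m + 1 ≤ finrank ℝ (B × (F →L[ℝ] ℝ)) := by exact_mod_cast h1
    omega
  rcases isEmpty_or_nonempty M with hM | ⟨⟨x₀⟩⟩
  · exact ⟨0, fun x => hM.elim x⟩
  obtain ⟨j, hj⟩ : ∃ j, ℓ j ≠ 0 := by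
    by_contra! h
    exact hℓ ⟨x₀, 0, funext fun i => by simp [h i]⟩
  -- A covector `ξ` that annihilates these combinations at `x` has values `ξ (t i x)` proportional
  -- to `ℓ i`. Either all of them vanish, so that `ξ = 0` as `t` generates, or rescaling `ξ`
  -- exhibits `ℓ` as a vector of values, contrary to its choice.
  refine ⟨fun i => t (j.succAbove i) - (ℓ (j.succAbove i) / ℓ j) • t j, fun x hx => ?_⟩
  by_contra hne
  obtain ⟨ξ, hξ0, hξ⟩ := Submodule.exists_le_ker_of_lt_top _ (lt_top_iff_ne_top.2 hne)
  have hval (i : Fin (m + 1)) : ξ (t i x) = ℓ i / ℓ j * ξ (t j x) := by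
    rcases eq_or_ne i j with rfl | hij
    · rw [div_self hj, one_mul]
    · obtain ⟨i, rfl⟩ := Fin.exists_succAbove_eq hij
      have h := hξ (Submodule.subset_span (mem_range_self i))
      rw [LinearMap.mem_ker, ContMDiffSection.coe_sub, ContMDiffSection.coe_smul] at h
      simpa [sub_eq_zero] using h
  by_cases h0 : ξ (t j x) = 0
  · refine hξ0 (LinearMap.ker_eq_top.1 ?_)
    rw [eq_top_iff, ← ht x hx, Submodule.span_le]
    rintro _ ⟨i, rfl⟩
    simpa [h0] using hval i
  · refine hℓ ⟨x, (ℓ j / ξ (t j x)) • ξ, funext fun i => ?_⟩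
    rw [LinearMap.smul_apply, hval i, smul_eq_mul]
    field_simp

/-- Over a neighborhood of a point, a smooth vector bundle is generated by global sections. -/
theorem exists_generatesOn_nhds [T2Space M] [SigmaCompactSpace M] (x₀ : M) :
    ∃ U ∈ 𝓝 x₀, ∃ t : Fin (finrank ℝ F) → Cₛ^∞⟮𝓘(ℝ, B); F, V⟯, GeneratesOn t U := by
  have : LocallyCompactSpace M := ChartedSpace.locallyCompactSpace B M
  let τ := trivializationAt F V x₀
  have hx₀ : x₀ ∈ τ.baseSet := mem_baseSet_trivializationAt F V x₀
  let b := Module.finBasis ℝ F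
  obtain ⟨C, hC, hCc, hCτ⟩ := exists_mem_nhds_isClosed_subset (τ.open_baseSet.mem_nhds hx₀)
  -- The cut-off equals one near `x₀` and has support in the base set, so that it turns the local
  -- frame into global sections without changing it near `x₀`.
  obtain ⟨χ, hχ, hχ0, -⟩ := exists_contMDiffMap_one_nhds_of_subset_interior (n := ⊤) 𝓘(ℝ, B)
    (isClosed_singleton (x := x₀)) (by simpa [mem_interior_iff_mem_nhds] using hC)
  have hsupp : tsupport χ ⊆ τ.baseSet :=
    (closure_minimal (fun x hx => by by_contra h; exact hx (hχ0 x h)) hCc).trans hCτ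
  have hsm (i) : ContMDiff 𝓘(ℝ, B) (𝓘(ℝ, B).prod 𝓘(ℝ, F)) ∞
      fun x => TotalSpace.mk' F x ((χ x) • τ.localFrame b i x) :=
    ContMDiffOn.smul_section_of_tsupport χ.contMDiff.contMDiffOn τ.open_baseSet hsupp
      (τ.contMDiffOn_localFrame_baseSet ∞ b i)
  rw [nhdsSet_singleton] at hχ
  refine ⟨_, Filter.inter_mem hχ (τ.open_baseSet.mem_nhds hx₀), fun i => ⟨_, hsm i⟩, ?_⟩
  rintro x ⟨hx1, hx2⟩
  have hx1' : χ x = 1 := hx1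
  have e : (fun i => (⟨_, hsm i⟩ : Cₛ^∞⟮𝓘(ℝ, B); F, V⟯) x) = τ.basisAt b hx2 := by
    funext i
    change χ x • τ.localFrame b i x = _
    rw [hx1', one_smul, τ.localFrame_apply_of_mem_baseSet b hx2]
  rw [e]
  exact (τ.basisAt b hx2).span_eq

/-- Local generating families are concatenated along a finite cover; the number of sections obtained
here still depends on `K`. -/
theorem exists_generatesOn_isCompact [T2Space M] [SigmaCompactSpace M] {K : Set M}
    (hK : IsCompact K) : ∃ (m : ℕ) (t : Fin m → Cₛ^∞⟮𝓘(ℝ, B); F, V⟯), GeneratesOn t K := by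
  refine hK.induction_on ⟨0, 0, fun x hx => hx.elim⟩ ?_ ?_ ?_
  · rintro K K' h ⟨m, t, ht⟩
    exact ⟨m, t, fun x hx => ht x (h hx)⟩
  · rintro K K' ⟨m, t, ht⟩ ⟨m', t', ht'⟩
    refine ⟨m + m', Fin.append t t', ?_⟩
    rintro x (hx | hx)
    · refine GeneratesOn.of_range_subset ht
        (fun x _ i => Submodule.subset_span ⟨Fin.castAdd m' i, ?_⟩) x hx
      simp
    · refine GeneratesOn.of_range_subset ht'
        (fun x _ i => Submodule.subset_span ⟨Fin.natAdd m i, ?_⟩) x hx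
      simp
  · intro x _
    obtain ⟨U, hU, t, ht⟩ := exists_generatesOn_nhds (F := F) (V := V) (B := B) x
    exact ⟨U, mem_nhdsWithin_of_mem_nhds hU, _, t, ht⟩

/-- Over compact sets, a smooth vector bundle is generated by a number of sections which depends
only on the dimensions. -/
theorem exists_generatesOn_isCompact_finrank [T2Space M] [SecondCountableTopology M]
    [SigmaCompactSpace M] {K : Set M} (hK : IsCompact K) :
    ∃ t : Fin (finrank ℝ (B × (F →L[ℝ] ℝ))) → Cₛ^∞⟮𝓘(ℝ, B); F, V⟯, GeneratesOn t K := by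
  obtain ⟨m, t, ht⟩ := exists_generatesOn_isCompact (F := F) (V := V) (B := B) hK
  rcases le_total m (finrank ℝ (B × (F →L[ℝ] ℝ))) with hm | hm
  · refine ⟨fun i => if h : i.1 < m then t ⟨i, h⟩ else 0, GeneratesOn.of_range_subset ht
      fun x _ i => Submodule.subset_span ⟨Fin.castLE hm i, ?_⟩⟩
    simp
  -- Sections are dropped one at a time, as long as there are more than the dimension bound.
  · refine Nat.decreasingInduction' (P := fun k => ∃ t : Fin k → Cₛ^∞⟮𝓘(ℝ, B); F, V⟯,
      GeneratesOn t K) (fun k _ hk => ?_) hm ⟨t, ht⟩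
    rintro ⟨t', ht'⟩
    exact ht'.exists_drop hk

variable (B F V) in
/-- A smooth vector bundle over a second countable manifold has a finite generating family of
global sections. -/
theorem exists_finite_generatesOn_univ [T2Space M] [SecondCountableTopology M] :
    ∃ (m : ℕ) (t : Fin m → Cₛ^∞⟮𝓘(ℝ, B); F, V⟯), GeneratesOn t univ := by
  have : LocallyCompactSpace M := ChartedSpace.locallyCompactSpace B M
  -- The shift makes the first set empty, so that every point first appears at a positive index `i +
  -- 1`. That point then lies in `W i`, and `t i` generates there. The truncated `i - 1` for `i = 0`
  -- gives `K 0 = ∅`, as required.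
  let K := (CompactExhaustion.choice M).shiftr
  have hK0 : K 0 = ∅ := rfl
  choose t ht using fun i => exists_generatesOn_isCompact_finrank (F := F) (V := V) (B := B)
    (K.isCompact (i + 1))
  let W (i : ℕ) : Set M := interior (K (i + 2)) \ K (i - 1)
  have hWo (i : ℕ) : IsOpen (W i) := isOpen_interior.sdiff (K.isCompact _).isClosed
  choose χ hχW hχ _ using fun i => (hWo i).exists_contMDiff_support_eq (n := ⊤) 𝓘(ℝ, B)
  have hmem {i : ℕ} {x : M} : χ i x ≠ 0 ↔ x ∈ W i := by rw [← hχW i]; rfl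
  have hdisj {i j : ℕ} (hij : i + 3 ≤ j) {x : M} (hx : x ∈ W i) : x ∉ W j := fun hx' =>
    hx'.2 (K.subset (by omega) (interior_subset hx.1))
  have hfin : LocallyFinite W := fun x => by
    refine ⟨interior (K (K.find x + 1)), isOpen_interior.mem_nhds
      (K.subset_interior_succ _ (K.mem_find x)), (finite_le_nat (K.find x + 2)).subset ?_⟩
    rintro j ⟨y, hy, hy'⟩
    by_contra h
    simp only [mem_ofPred_eq, not_le] at h
    exact hy.2 (K.subset (by omega) (interior_subset hy'))
  let ι := Fin 3 × Fin (finrank ℝ (B × (F →L[ℝ] ℝ)))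
  -- Shells whose indices differ by at least three are disjoint. Within one residue class modulo 3
  -- the cut-off sections therefore have disjoint supports where they are nonzero, and at a point of
  -- `W i` only the term of index `i` survives in the class of `i`.
  let σ (a : ι) (x : M) : V x := ∑ᶠ q : ℕ, χ (3 * q + a.1) x • t (3 * q + a.1) a.2 x
  have hσ (a : ι) : ContMDiff 𝓘(ℝ, B) (𝓘(ℝ, B).prod 𝓘(ℝ, F)) ∞
      fun x => TotalSpace.mk' F x (σ a x) := by
    refine ContMDiff.finsum_section_of_locallyFinite ?_
      fun q => (hχ _).smul_section (t _ a.2).contMDiff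
    have hinj : Function.Injective fun q : ℕ => 3 * q + (a.1 : ℕ) := fun q q' h => by
      simp only at h; omega
    refine (hfin.comp_injective hinj).subset fun q x hx => hmem.1 fun h => hx ?_
    simp [h]
  have hgen : GeneratesOn (fun a => (⟨σ a, hσ a⟩ : Cₛ^∞⟮𝓘(ℝ, B); F, V⟯)) univ := by
    intro x _
    obtain ⟨i, hi, hiW⟩ : ∃ i, x ∈ K (i + 1) ∧ x ∈ W i := by
      have hf : K.find x ≠ 0 := fun h => by
        have := K.mem_find x
        rw [h, hK0] at this
        exact this
      obtain ⟨i, hi⟩ := Nat.exists_eq_succ_of_ne_zero hf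
      have h1 : x ∈ K (i + 1) := by have := K.mem_find x; rwa [hi] at this
      refine ⟨i, h1, K.subset_interior_succ _ h1, fun h => ?_⟩
      have := K.mem_iff_find_le.1 h
      omega
    rw [eq_top_iff, ← ht i x hi, Submodule.span_le]
    rintro _ ⟨k, rfl⟩
    let a : ι := ⟨⟨i % 3, Nat.mod_lt _ (by norm_num)⟩, k⟩
    have hdiv : 3 * (i / 3) + i % 3 = i := Nat.div_add_mod i 3
    have hval : σ a x = χ i x • t i k x := by
      have h1 : σ a x = χ (3 * (i / 3) + i % 3) x • t (3 * (i / 3) + i % 3) k x := by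
        refine finsum_eq_single _ (i / 3) fun q hq => ?_
        have : χ (3 * q + i % 3) x = 0 := by
          by_contra h
          have h' := hmem.1 h
          rcases lt_or_gt_of_ne hq with hlt | hlt
          · exact hdisj (by omega) h' hiW
          · exact hdisj (by omega) hiW h'
        exact (congrArg (· • _) this).trans (zero_smul ℝ _)
      rw [hdiv] at h1
      exact h1
    have hχi : χ i x ≠ 0 := hmem.2 hiW
    have : t i k x = (χ i x)⁻¹ • σ a x := by rw [hval, inv_smul_smul₀ hχi]
    change t i k x ∈ _
    rw [this]
    exact Submodule.smul_mem _ _ (Submodule.subset_span ⟨a, rfl⟩)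
  let e := Fintype.equivFin ι
  refine ⟨Fintype.card ι, fun k => ⟨σ (e.symm k), hσ _⟩,
    hgen.of_range_subset fun x _ a => Submodule.subset_span ⟨e a, ?_⟩⟩
  change σ (e.symm (e a)) x = σ a x
  rw [e.symm_apply_apply]

end GeneratingSections

end

noncomputable section

/-! ### Real smoothness of `𝕂`-linear and bilinear expressions. -/

section SmoothOperatorFamilies

variable {𝕂 : Type*} [RCLike 𝕂]
  {B : Type*} [NormedAddCommGroup B] [NormedSpace ℝ B]
  {M : Type*} [TopologicalSpace M] [ChartedSpace B M]
  {G : Type*} [NormedAddCommGroup G] [NormedSpace 𝕂 G] [NormedSpace ℝ G] [IsScalarTower ℝ 𝕂 G]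
  {G' : Type*} [NormedAddCommGroup G'] [NormedSpace 𝕂 G'] [NormedSpace ℝ G']
  [IsScalarTower ℝ 𝕂 G']
  {G'' : Type*} [NormedAddCommGroup G''] [NormedSpace 𝕂 G''] [NormedSpace ℝ G'']
  [IsScalarTower ℝ 𝕂 G'']

theorem ContMDiffAt.rclike_bilinear (β : G →L[𝕂] G' →L[𝕂] G'') {f : M → G} {g : M → G'} {x : M}
    (hf : ContMDiffAt 𝓘(ℝ, B) 𝓘(ℝ, G) ∞ f x) (hg : ContMDiffAt 𝓘(ℝ, B) 𝓘(ℝ, G') ∞ g x) :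
    ContMDiffAt 𝓘(ℝ, B) 𝓘(ℝ, G'') ∞ (fun y => β (f y) (g y)) x := by
  have hβ : ContDiff ℝ ∞ fun p : G × G' => β p.1 p.2 :=
    β.isBoundedBilinearMap.contDiff.restrict_scalars ℝ
  exact hβ.contMDiff.contMDiffAt.comp x (hf.prodMk_space hg)

theorem ContMDiffAt.rclike_clm (L : G →L[𝕂] G') {f : M → G} {x : M}
    (hf : ContMDiffAt 𝓘(ℝ, B) 𝓘(ℝ, G) ∞ f x) :
    ContMDiffAt 𝓘(ℝ, B) 𝓘(ℝ, G') ∞ (fun y => L (f y)) x :=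
  ((L.contDiff (n := ∞)).restrict_scalars ℝ).contMDiff.contMDiffAt.comp x hf

/-- In finite dimension an operator is a fixed linear expression in its values on a basis, `f = ∑
b_i^* ⊗ f(b_i)`. -/
theorem contMDiffAt_rclike_clm_of_apply [FiniteDimensional 𝕂 G] {f : M → G →L[𝕂] G'} {x : M}
    (h : ∀ v, ContMDiffAt 𝓘(ℝ, B) 𝓘(ℝ, G') ∞ (fun y => f y v) x) :
    ContMDiffAt 𝓘(ℝ, B) 𝓘(ℝ, G →L[𝕂] G') ∞ f x := by
  let b := Module.finBasis 𝕂 G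
  have hf : f = fun y => ∑ i, ContinuousLinearMap.smulRightL 𝕂 G G'
      (LinearMap.toContinuousLinearMap (b.coord i)) (f y (b i)) := by
    funext y
    ext v
    have h' := congrArg (f y) (b.sum_repr v)
    rw [map_sum] at h'
    simp [← h']
  rw [hf]
  exact contMDiffAt_finsetSum fun i _ => (h (b i)).rclike_clm _

end SmoothOperatorFamilies

/-! ### Smooth functionals dual to a generating family. -/

section DualBasis

variable {𝕂 : Type*} [RCLike 𝕂]
  {B : Type*} [NormedAddCommGroup B] [NormedSpace ℝ B]
  {M : Type*} [TopologicalSpace M] [ChartedSpace B M] [IsManifold 𝓘(ℝ, B) ∞ M]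
  {F : Type*} [NormedAddCommGroup F] [NormedSpace 𝕂 F] [NormedSpace ℝ F] [IsScalarTower ℝ 𝕂 F]
  {V : M → Type*} [∀ x, AddCommGroup (V x)] [∀ x, Module 𝕂 (V x)] [∀ x, Module ℝ (V x)]
  [∀ x, IsScalarTower ℝ 𝕂 (V x)]
  [TopologicalSpace (TotalSpace F V)] [∀ x, TopologicalSpace (V x)] [FiberBundle F V]
  [VectorBundle 𝕂 F V] [VectorBundle ℝ F V] [ContMDiffVectorBundle ∞ F V 𝓘(ℝ, B)]

variable (B F) in
/-- A family of linear functionals on the fibers is smooth at a point if it maps sections which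
are smooth at this point to functions which are smooth at this point. -/
def SmoothFunctionalAt (d : ∀ x, V x →ₗ[𝕂] 𝕂) (x : M) : Prop :=
  ∀ s : ∀ x, V x,
    ContMDiffAt 𝓘(ℝ, B) (𝓘(ℝ, B).prod 𝓘(ℝ, F)) ∞ (fun y => TotalSpace.mk' F y (s y)) x →
      ContMDiffAt 𝓘(ℝ, B) 𝓘(ℝ, 𝕂) ∞ (fun y => d y (s y)) x

/-- The values of `t` at `x` make `𝕂^m → F` surjective; the `r k` are the components of a linear
right inverse. -/
theorem GeneratesOn.exists_functionals [FiniteDimensional 𝕂 F] {m : ℕ}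
    {t : Fin m → Cₛ^∞⟮𝓘(ℝ, B); F, V⟯} (ht : GeneratesOn t univ) (τ : Trivialization F (π F V))
    [MemTrivializationAtlas τ] {x : M} (hx : x ∈ τ.baseSet) :
    ∃ r : Fin m → F →L[𝕂] 𝕂, ∀ w, ∑ k, r k w • (τ ⟨x, t k x⟩).2 = w := by
  let S : (Fin m → 𝕂) →ₗ[𝕂] F := Fintype.linearCombination 𝕂 fun k => (τ ⟨x, t k x⟩).2
  have hS : LinearMap.range S = ⊤ := by
    rw [Fintype.range_linearCombination]
    -- Generation is formulated with the real span, which lies in the span over `𝕂`.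
    have h1 : Submodule.span 𝕂 (range fun k => t k x) = ⊤ := by
      refine eq_top_iff.2 fun v _ => Submodule.span_subset_span ℝ 𝕂 _ ?_
      rw [ht x (mem_univ x)]
      trivial
    have h2 := congrArg (Submodule.map (τ.linearEquivAt 𝕂 x hx).toLinearMap) h1
    rw [Submodule.map_span, ← range_comp, Submodule.map_top, LinearEquiv.range] at h2
    exact h2
  obtain ⟨R, hR⟩ := S.exists_rightInverse_of_surjective hS
  refine ⟨fun k => LinearMap.toContinuousLinearMap (LinearMap.proj k ∘ₗ R), fun w => ?_⟩
  exact LinearMap.congr_fun hR w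

theorem GeneratesOn.exists_dual_nhds [FiniteDimensional 𝕂 F] {m : ℕ}
    {t : Fin m → Cₛ^∞⟮𝓘(ℝ, B); F, V⟯} (ht : GeneratesOn t univ) (x₀ : M) :
    ∃ O : Set M, IsOpen O ∧ x₀ ∈ O ∧ ∃ d : Fin m → ∀ x, V x →ₗ[𝕂] 𝕂,
      (∀ k, ∀ x ∈ O, SmoothFunctionalAt B F (d k) x) ∧
        ∀ x ∈ O, ∀ v, ∑ k, d k x v • t k x = v := by
  have : CompleteSpace F := FiniteDimensional.complete 𝕂 F
  let τ := trivializationAt F V x₀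
  have hx₀ : x₀ ∈ τ.baseSet := mem_baseSet_trivializationAt F V x₀
  obtain ⟨r, hr⟩ := ht.exists_functionals (𝕂 := 𝕂) τ hx₀
  let u (k : Fin m) (x : M) : F := (τ ⟨x, t k x⟩).2
  -- The coefficients `r` are frozen at `x₀`, so they reproduce vectors only there: `G x₀ = 1`. Near
  -- `x₀` the operator `G x` stays invertible, and composing `r k` with its inverse corrects the
  -- error. `Ring.inverse` is smooth at units.
  let G (x : M) : F →L[𝕂] F := ∑ k, ContinuousLinearMap.smulRightL 𝕂 F F (r k) (u k x)
  have hGx (x : M) (w : F) : G x w = ∑ k, r k w • u k x := by simp [G]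
  have hG : ∀ x ∈ τ.baseSet, ContMDiffAt 𝓘(ℝ, B) 𝓘(ℝ, F →L[𝕂] F) ∞ G x := fun x hx =>
    contMDiffAt_finsetSum fun k _ =>
      ((τ.contMDiffAt_section_iff hx).1 ((t k).contMDiff x)).rclike_clm _
  have hG₀ : G x₀ = 1 := by ext w; rw [hGx]; exact hr w
  let O : Set M := τ.baseSet ∩ G ⁻¹' {a | IsUnit a}
  have hGc : ContinuousOn G τ.baseSet := fun x hx => (hG x hx).continuousAt.continuousWithinAt
  have hO : IsOpen O := hGc.isOpen_inter_preimage τ.open_baseSet Units.isOpen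
  refine ⟨O, hO, ⟨hx₀, by simp [hG₀]⟩, fun k x =>
    (r k).toLinearMap ∘ₗ (Ring.inverse (G x)).toLinearMap ∘ₗ τ.linearMapAt 𝕂 x, ?_, ?_⟩
  · intro k x hx s hs
    have h1 := (τ.contMDiffAt_section_iff hx.1).1 hs
    have h2 : ContMDiffAt 𝓘(ℝ, B) 𝓘(ℝ, F →L[𝕂] F) ∞ (fun y => Ring.inverse (G y)) x := by
      obtain ⟨a, ha⟩ := hx.2
      have h3 : ContDiffAt ℝ ∞ (Ring.inverse : (F →L[𝕂] F) → F →L[𝕂] F) (G x) := by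
        rw [← ha]
        exact (contDiffAt_ringInverse 𝕂 a).restrict_scalars ℝ
      exact h3.contMDiffAt.comp x (hG x hx.1)
    refine ((h2.rclike_bilinear (ContinuousLinearMap.id 𝕂 (F →L[𝕂] F)) h1).rclike_clm
      (r k)).congr_of_eventuallyEq ?_
    filter_upwards [τ.open_baseSet.mem_nhds hx.1] with y hy
    simp [hy]
  · intro x hx v
    apply (τ.linearEquivAt 𝕂 x hx.1).injective
    have e (w : V x) : τ.linearEquivAt 𝕂 x hx.1 w = (τ ⟨x, w⟩).2 := rfl
    simp_rw [map_sum, LinearEquiv.map_smul, e]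
    have h := hGx x (Ring.inverse (G x) (τ ⟨x, v⟩).2)
    have h' : G x (Ring.inverse (G x) (τ ⟨x, v⟩).2) = (τ ⟨x, v⟩).2 :=
      congrArg (fun A : F →L[𝕂] F => A (τ ⟨x, v⟩).2) (Ring.mul_inverse_cancel _ hx.2)
    rw [h'] at h
    simpa [τ.linearMapAt_apply, hx.1, u] using h.symm

theorem SmoothPartitionOfUnity.finite_support_smul {ι : Type*} {s : Set M}
    (ρ : SmoothPartitionOfUnity ι 𝓘(ℝ, B) M s) (x : M) {P : Type*} [AddCommGroup P] [Module ℝ P]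
    (g : ι → P) : (Function.support fun i => ρ i x • g i).Finite :=
  (ρ.locallyFinite.point_finite x).subset fun i hi h => hi (by simp [show ρ i x = 0 from h])

variable (𝕂 B F V) in
/-- The module of sections of a smooth vector bundle over a second countable manifold has a
finite dual basis, given by smooth fiberwise linear functionals. -/
theorem exists_dual_basis_sections [FiniteDimensional ℝ B] [T2Space M] [SecondCountableTopology M]
    [FiniteDimensional 𝕂 F] :
    ∃ (m : ℕ) (t : Fin m → Cₛ^∞⟮𝓘(ℝ, B); F, V⟯) (d : Fin m → ∀ x, V x →ₗ[𝕂] 𝕂),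
      (∀ k x, SmoothFunctionalAt B F (d k) x) ∧ ∀ x v, ∑ k, d k x v • t k x = v := by
  have : LocallyCompactSpace M := ChartedSpace.locallyCompactSpace B M
  have : FiniteDimensional ℝ F := Module.Finite.trans 𝕂 F
  obtain ⟨m, t, ht⟩ := exists_finite_generatesOn_univ B F V
  choose O hO hxO d hd hsum using fun x₀ => ht.exists_dual_nhds (𝕂 := 𝕂) x₀
  obtain ⟨ρ, hρ⟩ := SmoothPartitionOfUnity.exists_isSubordinate 𝓘(ℝ, B) isClosed_univ O hO
    fun x _ => mem_iUnion.2 ⟨x, hxO x⟩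
  have hd' (k x v) : (∑ᶠ i, ρ i x • d i k x) v = ∑ᶠ i, ρ i x • d i k x v :=
    (LinearMap.applyₗ (R := 𝕂) v : (V x →ₗ[𝕂] 𝕂) →ₗ[𝕂] 𝕂).toAddMonoidHom.map_finsum (ρ.finite_support_smul x _)
  -- The sections `t` are global and the same for all local solutions, so the condition `∑ d_k(v)
  -- t_k = v` is affine in `d` and survives averaging with a partition of unity.
  refine ⟨m, t, fun k x => ∑ᶠ i, ρ i x • d i k x, fun k x s hs => ?_, fun x v => ?_⟩
  · simp only [hd']
    exact ρ.contMDiffAt_finsum fun i hi => hd i k x (hρ i hi) s hs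
  · simp only [hd']
    have h1 (k) : (∑ᶠ i, ρ i x • d i k x v) • t k x = ∑ᶠ i, ρ i x • d i k x v • t k x := by
      have := ((LinearMap.toSpanSingleton 𝕂 (V x) (t k x)).toAddMonoidHom.map_finsum
        (ρ.finite_support_smul x fun i => d i k x v))
      simpa using this
    simp only [h1]
    rw [← finsum_sum_comm _ _ fun k _ => ρ.finite_support_smul x fun i => d i k x v • t k x]
    have h2 (i) : ∑ k, ρ i x • d i k x v • t k x = ρ i x • v := by
      rw [← Finset.smul_sum]
      by_cases h : ρ i x = 0
      · simp [h]
      · rw [hsum i x (hρ i (subset_closure h)) v]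
    simp only [h2]
    have h3 := (LinearMap.toSpanSingleton ℝ (V x) v).toAddMonoidHom.map_finsum
      (ρ.locallyFinite.point_finite x)
    have h4 : ∑ᶠ i, ρ i x • v = (∑ᶠ i, ρ i x) • v := by simpa using h3.symm
    rw [h4, ρ.sum_eq_one (mem_univ x), one_smul]

end DualBasis

end

noncomputable section

/-! ### Trivializations of the tensor bundle and contraction. -/

section TensorTrivialization

variable (𝕂 : Type*) [RCLike 𝕂] {M : Type*} [TopologicalSpace M]
  {F₁ : Type*} [NormedAddCommGroup F₁] [NormedSpace 𝕂 F₁] [FiniteDimensional 𝕂 F₁]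
  {V : M → Type*} [∀ x, AddCommGroup (V x)] [∀ x, Module 𝕂 (V x)]
  [TopologicalSpace (TotalSpace F₁ V)]
  {F₂ : Type*} [NormedAddCommGroup F₂] [NormedSpace 𝕂 F₂] [FiniteDimensional 𝕂 F₂]
  {W : M → Type*} [∀ x, AddCommGroup (W x)] [∀ x, Module 𝕂 (W x)]
  [TopologicalSpace (TotalSpace F₂ W)]
  [∀ x, TopologicalSpace (V x)] [FiberBundle F₁ V] [VectorBundle 𝕂 F₁ V]
  [∀ x, TopologicalSpace (W x)] [FiberBundle F₂ W] [VectorBundle 𝕂 F₂ W]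

/-- The trivialization of the tensor product bundle induced by trivializations of the factors. -/
def tensorTrivialization (τ₁ : Trivialization F₁ (π F₁ V)) (τ₂ : Trivialization F₂ (π F₂ W))
    [h₁ : MemTrivializationAtlas τ₁] [h₂ : MemTrivializationAtlas τ₂] :
    Trivialization (TensorModel 𝕂 F₁ F₂) (π (TensorModel 𝕂 F₁ F₂) (TensorBundle 𝕂 V W)) :=
  (tensorPrebundle 𝕂 F₁ V F₂ W).trivializationOfMemPretrivializationAtlas
    ⟨τ₁, τ₂, h₁, h₂, rfl⟩

theorem tensorTrivialization_mem_atlas (τ₁ : Trivialization F₁ (π F₁ V))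
    (τ₂ : Trivialization F₂ (π F₂ W)) [h₁ : MemTrivializationAtlas τ₁]
    [h₂ : MemTrivializationAtlas τ₂] : tensorTrivialization 𝕂 τ₁ τ₂ ∈
      trivializationAtlas (TensorModel 𝕂 F₁ F₂) (TensorBundle 𝕂 V W) :=
  ⟨_, ⟨τ₁, τ₂, h₁, h₂, rfl⟩, rfl⟩

instance (τ₁ : Trivialization F₁ (π F₁ V)) (τ₂ : Trivialization F₂ (π F₂ W))
    [MemTrivializationAtlas τ₁] [MemTrivializationAtlas τ₂] :
    MemTrivializationAtlas (tensorTrivialization 𝕂 τ₁ τ₂) :=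
  ⟨tensorTrivialization_mem_atlas 𝕂 τ₁ τ₂⟩

/-- The atlas of the tensor bundle consists of these trivializations by construction, so bounds for
seminorms need only be checked on them. -/
theorem exists_eq_tensorTrivialization {e : Trivialization (TensorModel 𝕂 F₁ F₂)
      (π (TensorModel 𝕂 F₁ F₂) (TensorBundle 𝕂 V W))}
    (he : e ∈ trivializationAtlas (TensorModel 𝕂 F₁ F₂) (TensorBundle 𝕂 V W)) :
    ∃ (τ₁ : Trivialization F₁ (π F₁ V)) (τ₂ : Trivialization F₂ (π F₂ W))
      (_ : MemTrivializationAtlas τ₁) (_ : MemTrivializationAtlas τ₂),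
        e = tensorTrivialization 𝕂 τ₁ τ₂ := by
  obtain ⟨_, ⟨τ₁, τ₂, h₁, h₂, rfl⟩, rfl⟩ := he
  exact ⟨τ₁, τ₂, h₁, h₂, rfl⟩

theorem tensorTrivialization_apply (τ₁ : Trivialization F₁ (π F₁ V))
    (τ₂ : Trivialization F₂ (π F₂ W)) [MemTrivializationAtlas τ₁] [MemTrivializationAtlas τ₂]
    (x : M) (z : TensorBundle 𝕂 V W x) : (tensorTrivialization 𝕂 τ₁ τ₂ ⟨x, z⟩).2 =
      TensorProduct.map (τ₁.linearMapAt 𝕂 x) (τ₂.linearMapAt 𝕂 x) z := rfl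

theorem tensorTrivialization_mk (τ₁ : Trivialization F₁ (π F₁ V))
    (τ₂ : Trivialization F₂ (π F₂ W)) [MemTrivializationAtlas τ₁] [MemTrivializationAtlas τ₂]
    {x : M} (h₁ : x ∈ τ₁.baseSet) (h₂ : x ∈ τ₂.baseSet) (v : V x) (w : W x) :
    (tensorTrivialization 𝕂 τ₁ τ₂ ⟨x, TensorBundle.mk 𝕂 V W x v w⟩).2 =
      TensorModel.mkL 𝕂 F₁ F₂ (τ₁ ⟨x, v⟩).2 (τ₂ ⟨x, w⟩).2 := by
  change (τ₁.linearMapAt 𝕂 x v) ⊗ₜ[𝕂] (τ₂.linearMapAt 𝕂 x w) = _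
  rw [τ₁.linearMapAt_apply, τ₂.linearMapAt_apply, if_pos h₁, if_pos h₂]
  rfl

/-- Contraction of the second factor with a linear functional, `v ⊗ w ↦ δ w • v`. -/
def TensorBundle.contract {x : M} (δ : W x →ₗ[𝕂] 𝕂) : TensorBundle 𝕂 V W x →ₗ[𝕂] V x :=
  TensorProduct.lift ((LinearMap.lsmul 𝕂 (V x)).flip.compl₂ δ)

theorem TensorBundle.contract_mk {x : M} (δ : W x →ₗ[𝕂] 𝕂) (v : V x) (w : W x) :
    TensorBundle.contract 𝕂 δ (TensorBundle.mk 𝕂 V W x v w) = δ w • v := rfl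

theorem TensorBundle.induction_on {x : M} {p : TensorBundle 𝕂 V W x → Prop}
    (z : TensorBundle 𝕂 V W x) (zero : p 0) (mk : ∀ v w, p (TensorBundle.mk 𝕂 V W x v w))
    (add : ∀ z z', p z → p z' → p (z + z')) : p z :=
  TensorProduct.induction_on z zero mk add

variable (F₁ F₂) in
/-- Contraction `(v ⊗ w, δ) ↦ δ w • v` of the model fibers, as a continuous bilinear map. -/
def TensorModel.contractL : TensorModel 𝕂 F₁ F₂ →L[𝕂] (F₂ →L[𝕂] 𝕂) →L[𝕂] F₁ :=
  LinearMap.toContinuousBilinearMap <| TensorProduct.lift <| LinearMap.mk₂ 𝕂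
    (fun v w => (LinearMap.toSpanSingleton 𝕂 F₁ v) ∘ₗ
      (ContinuousLinearMap.apply 𝕂 𝕂 w : (F₂ →L[𝕂] 𝕂) →L[𝕂] 𝕂).toLinearMap)
    (fun v v' w => by ext; simp) (fun c v w => by ext δ; exact smul_comm (δ w) c v)
    (fun v w w' => by ext; simp [add_smul]) (fun c v w => by ext; simp [mul_smul])

theorem TensorModel.contractL_mkL (v : F₁) (w : F₂) (δ : F₂ →L[𝕂] 𝕂) :
    TensorModel.contractL 𝕂 F₁ F₂ (TensorModel.mkL 𝕂 F₁ F₂ v w) δ = δ w • v := rfl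

variable {𝕂} in
/-- The representation of a family of linear functionals on the fibers with respect to a
trivialization. -/
def functionalRep (τ : Trivialization F₂ (π F₂ W)) [MemTrivializationAtlas τ]
    (d : ∀ x, W x →ₗ[𝕂] 𝕂) (x : M) : F₂ →L[𝕂] 𝕂 :=
  LinearMap.toContinuousLinearMap (d x ∘ₗ τ.symmₗ 𝕂 x)

/-- In coordinates, contraction becomes one fixed bilinear map `TensorModel.contractL`, independent
of the point. Smoothness and continuity of `contractSection` both reduce to this. -/
theorem trivialization_contract (τ₁ : Trivialization F₁ (π F₁ V))
    (τ₂ : Trivialization F₂ (π F₂ W)) [MemTrivializationAtlas τ₁] [MemTrivializationAtlas τ₂]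
    {x : M} (h₁ : x ∈ τ₁.baseSet) (h₂ : x ∈ τ₂.baseSet) (d : ∀ x, W x →ₗ[𝕂] 𝕂)
    (z : TensorBundle 𝕂 V W x) : (τ₁ ⟨x, TensorBundle.contract 𝕂 (d x) z⟩).2 =
      TensorModel.contractL 𝕂 F₁ F₂ (tensorTrivialization 𝕂 τ₁ τ₂ ⟨x, z⟩).2
        (functionalRep τ₂ d x) := by
  have hlin (v : V x) : τ₁.linearMapAt 𝕂 x v = (τ₁ ⟨x, v⟩).2 := by
    rw [τ₁.linearMapAt_apply, if_pos h₁]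
  rw [← hlin]
  induction z using TensorBundle.induction_on with
  | zero =>
    rw [tensorTrivialization_apply, map_zero, map_zero]
    erw [map_zero]
    rfl
  | mk v w =>
    rw [tensorTrivialization_mk 𝕂 τ₁ τ₂ h₁ h₂, TensorBundle.contract_mk, map_smul, hlin,
      TensorModel.contractL_mkL]
    have := τ₂.symmₗ_linearMapAt (R := 𝕂) h₂ w
    rw [τ₂.linearMapAt_apply, if_pos h₂] at this
    congr 2
    exact congrArg (d x) this.symm
  | add z z' h h' =>
    rw [map_add, map_add, h, h', tensorTrivialization_apply, tensorTrivialization_apply,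
      tensorTrivialization_apply]
    erw [map_add, map_add]
    rfl

end TensorTrivialization

/-! ### Continuity of contraction and of the tensor product of sections. -/

section SectionMaps

variable (𝕂 : Type*) [RCLike 𝕂]
  {B : Type*} [NormedAddCommGroup B] [NormedSpace ℝ B]
  {M : Type*} [TopologicalSpace M] [ChartedSpace B M] [IsManifold 𝓘(ℝ, B) ∞ M]
  {F₁ : Type*} [NormedAddCommGroup F₁] [NormedSpace 𝕂 F₁] [NormedSpace ℝ F₁]
  [IsScalarTower ℝ 𝕂 F₁] [FiniteDimensional 𝕂 F₁]
  {V : M → Type*} [∀ x, AddCommGroup (V x)] [∀ x, Module 𝕂 (V x)] [∀ x, Module ℝ (V x)]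
  [∀ x, IsScalarTower ℝ 𝕂 (V x)]
  [TopologicalSpace (TotalSpace F₁ V)] [∀ x, TopologicalSpace (V x)] [FiberBundle F₁ V]
  [VectorBundle 𝕂 F₁ V] [VectorBundle ℝ F₁ V] [ContMDiffVectorBundle ∞ F₁ V 𝓘(ℝ, B)]
  {F₂ : Type*} [NormedAddCommGroup F₂] [NormedSpace 𝕂 F₂] [NormedSpace ℝ F₂]
  [IsScalarTower ℝ 𝕂 F₂] [FiniteDimensional 𝕂 F₂]
  {W : M → Type*} [∀ x, AddCommGroup (W x)] [∀ x, Module 𝕂 (W x)] [∀ x, Module ℝ (W x)]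
  [∀ x, IsScalarTower ℝ 𝕂 (W x)]
  [TopologicalSpace (TotalSpace F₂ W)] [∀ x, TopologicalSpace (W x)] [FiberBundle F₂ W]
  [VectorBundle 𝕂 F₂ W] [VectorBundle ℝ F₂ W] [ContMDiffVectorBundle ∞ F₂ W 𝓘(ℝ, B)]

/-- Smooth families of functionals have smooth local representations. -/
theorem contMDiffAt_functionalRep {d : ∀ x, W x →ₗ[𝕂] 𝕂}
    (τ : Trivialization F₂ (π F₂ W)) [MemTrivializationAtlas τ] {x : M} (hx : x ∈ τ.baseSet)
    (hd : SmoothFunctionalAt B F₂ d x) :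
    ContMDiffAt 𝓘(ℝ, B) 𝓘(ℝ, F₂ →L[𝕂] 𝕂) ∞ (functionalRep τ d) x := by
  -- Smoothness of the family is tested on the sections that are constant in the trivialization.
  refine contMDiffAt_rclike_clm_of_apply fun v => hd (fun y => τ.symmₗ 𝕂 y v) ?_
  refine (τ.contMDiffAt_section_iff hx).2 (contMDiffAt_const (c := v) |>.congr_of_eventuallyEq ?_)
  filter_upwards [τ.open_baseSet.mem_nhds hx] with y hy
  have := τ.linearMapAt_symmₗ (R := 𝕂) hy v
  rwa [τ.linearMapAt_apply, if_pos hy] at this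

/-- Contraction of sections of a tensor product bundle with a smooth family of functionals on the
fibers of the second factor. -/
def contractSection (d : ∀ x, W x →ₗ[𝕂] 𝕂) (hd : ∀ x, SmoothFunctionalAt B F₂ d x) :
    Cₛ^∞⟮𝓘(ℝ, B); TensorModel 𝕂 F₁ F₂, TensorBundle 𝕂 V W⟯ →ₗ[𝕂] Cₛ^∞⟮𝓘(ℝ, B); F₁, V⟯ where
  toFun ζ :=
    { toFun := fun x => TensorBundle.contract 𝕂 (d x) (ζ x)
      contMDiff_toFun := by
        intro x
        let τ₁ := trivializationAt F₁ V x
        let τ₂ := trivializationAt F₂ W x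
        have h₁ : x ∈ τ₁.baseSet := mem_baseSet_trivializationAt F₁ V x
        have h₂ : x ∈ τ₂.baseSet := mem_baseSet_trivializationAt F₂ W x
        have hζ := ((tensorTrivialization 𝕂 τ₁ τ₂).contMDiffAt_section_iff ⟨h₁, h₂⟩).1
          (ζ.contMDiff x)
        refine (τ₁.contMDiffAt_section_iff h₁).2 <| (hζ.rclike_bilinear
          (TensorModel.contractL 𝕂 F₁ F₂)
            (contMDiffAt_functionalRep 𝕂 τ₂ h₂ (hd x))).congr_of_eventuallyEq ?_
        filter_upwards [τ₁.open_baseSet.mem_nhds h₁, τ₂.open_baseSet.mem_nhds h₂] with y hy₁ hy₂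
        exact trivialization_contract 𝕂 τ₁ τ₂ hy₁ hy₂ d _ }
  map_add' ζ ζ' := by ext x; exact (TensorBundle.contract 𝕂 (d x)).map_add (ζ x) (ζ' x)
  map_smul' c ζ := by ext x; exact (TensorBundle.contract 𝕂 (d x)).map_smul c (ζ x)

/-- Finitely many continuous derivatives are bounded near a point; this supplies the constant for
the coefficients of a contraction. -/
theorem ContDiffAt.exists_eventually_norm_iteratedFDeriv_le {D G : Type*} [NormedAddCommGroup D]
    [NormedSpace ℝ D] [NormedAddCommGroup G] [NormedSpace ℝ G] {f : D → G} {z : D}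
    (hf : ContDiffAt ℝ ∞ f z) (k : ℕ) :
    ∃ b, ∀ᶠ y in 𝓝 z, ∀ j ≤ k, ‖iteratedFDeriv ℝ j f y‖ ≤ b := by
  have h (j : ℕ) : ∀ᶠ y in 𝓝 z, ‖iteratedFDeriv ℝ j f y‖ < ‖iteratedFDeriv ℝ j f z‖ + 1 :=
    (hf.continuousAt_iteratedFDeriv (k := j) (by exact_mod_cast le_top)).norm.eventually_lt
      continuousAt_const (lt_add_one _)
  refine ⟨∑ j ∈ Finset.range (k + 1), (‖iteratedFDeriv ℝ j f z‖ + 1), ?_⟩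
  filter_upwards [(Filter.eventually_all_finset (Finset.range (k + 1))).2 fun j _ => h j]
    with y hy j hj
  have hj' := Finset.mem_range.2 (Nat.lt_succ_of_le hj)
  exact (hy j hj').le.trans (Finset.single_le_sum
    (f := fun j => ‖iteratedFDeriv ℝ j f z‖ + 1) (fun _ _ => by positivity) hj')

/-- Contraction involves no derivatives of the section, so by Leibniz the derivatives of the result
up to order `k` are controlled by those of `ζ` up to order `k`, times local bounds for the
coefficients. -/
theorem continuous_contractSection [LocallyCompactSpace M] (d : ∀ x, W x →ₗ[𝕂] 𝕂)
    (hd : ∀ x, SmoothFunctionalAt B F₂ d x) :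
    Continuous (contractSection 𝕂 (F₁ := F₁) (V := V) d hd) := by
  refine continuous_of_localRep_le ((contractSection 𝕂 d hd).restrictScalars ℝ)
    fun φ hφ τ₁ hτ₁ x hx k => ?_
  have : MemTrivializationAtlas τ₁ := ⟨hτ₁⟩
  let τ₂ := trivializationAt F₂ W x
  have hx₂ : x ∈ τ₂.baseSet := mem_baseSet_trivializationAt F₂ W x
  obtain ⟨U, hU, hUs, p, hp, H⟩ := exists_seminorm_iteratedFDeriv_localRep_le hφ
    (tensorTrivialization_mem_atlas 𝕂 τ₁ τ₂) (x := x) ⟨hx.1, hx.2, hx₂⟩ k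
  let δ : B → F₂ →L[𝕂] 𝕂 := fun z => functionalRep τ₂ d (φ.symm z)
  have hδ {y : M} (hy : y ∈ φ.source) (hy₂ : y ∈ τ₂.baseSet) : ContDiffAt ℝ ∞ δ (φ y) := by
    have h1 : ContMDiffAt 𝓘(ℝ, B) 𝓘(ℝ, F₂ →L[𝕂] 𝕂) ∞ (functionalRep τ₂ d) (φ.symm (φ y)) := by
      rw [φ.left_inv hy]
      exact contMDiffAt_functionalRep 𝕂 τ₂ hy₂ (hd y)
    have h2 : ContMDiffAt 𝓘(ℝ, B) 𝓘(ℝ, B) ∞ φ.symm (φ y) :=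
      (contMDiffOn_symm_of_mem_maximalAtlas
        (StructureGroupoid.subset_maximalAtlas _ hφ)).contMDiffAt
          (φ.open_target.mem_nhds (φ.map_source hy))
    exact (h1.comp _ h2).contDiffAt
  obtain ⟨b, hb⟩ := (hδ hx.1 hx₂).exists_eventually_norm_iteratedFDeriv_le k
  have hb' := (φ.continuousAt hx.1).eventually hb
  have hb0 : 0 ≤ b := (norm_nonneg _).trans (hb.self_of_nhds 0 k.zero_le)
  let β := (TensorModel.contractL 𝕂 F₁ F₂).bilinearRestrictScalars ℝ
  -- The factor `‖β‖ * 2 ^ k` comes from the Leibniz estimate, `b` from the derivatives of the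
  -- functional.
  let C : NNReal := ⟨‖β‖ * 2 ^ k * b, by positivity⟩
  refine ⟨_, Filter.inter_mem hU hb', C • p, hp.const_smul C, fun ζ y hy => ?_⟩
  obtain ⟨hys, hy₁, hy₂⟩ := hUs hy.1
  have hζ := (contDiffAt_localRep hφ (tensorTrivialization_mem_atlas 𝕂 τ₁ τ₂) ζ
    ⟨hys, hy₁, hy₂⟩).of_le (m := k) (by exact_mod_cast le_top)
  have heq : localRep φ τ₁ (contractSection 𝕂 d hd ζ) =ᶠ[𝓝 (φ y)]
      fun z => β (localRep φ (tensorTrivialization 𝕂 τ₁ τ₂) ζ z) (δ z) := by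
    filter_upwards [localRep_domain_mem_nhds φ (tensorTrivialization 𝕂 τ₁ τ₂)
      (x := y) ⟨hys, hy₁, hy₂⟩] with z hz
    exact trivialization_contract 𝕂 τ₁ τ₂ hz.2.1 hz.2.2 d _
  change ‖iteratedFDeriv ℝ k (localRep φ τ₁ (contractSection 𝕂 d hd ζ)) (φ y)‖ ≤ _
  rw [(heq.iteratedFDeriv ℝ k).eq_of_nhds]
  refine (hζ.norm_iteratedFDeriv_bilinear_le_mul β ((hδ hys hy₂).of_le
    (by exact_mod_cast le_top)) (H ζ y hy.1) hy.2).trans_eq ?_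
  change _ = (‖β‖ * 2 ^ k * b) * p ζ
  ring

variable (B F₁ V F₂ W) in
/-- The bilinear map `(s, t) ↦ s ⊗ t` on sections. -/
def sectionTensorBilin : Cₛ^∞⟮𝓘(ℝ, B); F₁, V⟯ →ₗ[𝕂] Cₛ^∞⟮𝓘(ℝ, B); F₂, W⟯ →ₗ[𝕂]
    Cₛ^∞⟮𝓘(ℝ, B); TensorModel 𝕂 F₁ F₂, TensorBundle 𝕂 V W⟯ :=
  LinearMap.mk₂ 𝕂 (sectionTensor 𝕂)
    (fun s s' t => by ext x; exact TensorProduct.add_tmul (s x) (s' x) (t x))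
    (fun c s t => by ext x; exact TensorProduct.smul_tmul' c (s x) (t x))
    (fun s t t' => by ext x; exact TensorProduct.tmul_add (s x) (t x) (t' x))
    (fun c s t => by ext x; exact TensorProduct.tmul_smul c (s x) (t x))

/-- In product trivializations this is a fixed bilinear map applied to the two local
representations, so Leibniz bounds it by a product of seminorms. -/
theorem continuous_sectionTensor [LocallyCompactSpace M] :
    Continuous fun z : Cₛ^∞⟮𝓘(ℝ, B); F₁, V⟯ × Cₛ^∞⟮𝓘(ℝ, B); F₂, W⟯ =>
      sectionTensor 𝕂 z.1 z.2 := by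
  refine continuous_bilinear_of_localRep_le
    ((sectionTensorBilin 𝕂 B F₁ V F₂ W).restrictScalars₁₂ ℝ ℝ) fun φ hφ e he x hx k => ?_
  obtain ⟨τ₁, τ₂, h₁, h₂, rfl⟩ := exists_eq_tensorTrivialization 𝕂 he
  obtain ⟨U₁, hU₁, hUs₁, p, hp, H₁⟩ :=
    exists_seminorm_iteratedFDeriv_localRep_le hφ h₁.out (x := x) ⟨hx.1, hx.2.1⟩ k
  obtain ⟨U₂, hU₂, hUs₂, q, hq, H₂⟩ :=
    exists_seminorm_iteratedFDeriv_localRep_le hφ h₂.out (x := x) ⟨hx.1, hx.2.2⟩ k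
  let β := (TensorModel.mkL 𝕂 F₁ F₂).bilinearRestrictScalars ℝ
  let C : NNReal := ⟨‖β‖ * 2 ^ k, by positivity⟩
  refine ⟨_, Filter.inter_mem hU₁ hU₂, C • p, q, hp.const_smul C, hq, fun s t y hy => ?_⟩
  have hy₁ := hUs₁ hy.1
  have hy₂ := hUs₂ hy.2
  have heq : localRep φ (tensorTrivialization 𝕂 τ₁ τ₂) (sectionTensor 𝕂 s t) =ᶠ[𝓝 (φ y)]
      fun z => β (localRep φ τ₁ s z) (localRep φ τ₂ t z) := by
    filter_upwards [localRep_domain_mem_nhds φ τ₁ hy₁, localRep_domain_mem_nhds φ τ₂ hy₂]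
      with z hz₁ hz₂
    exact tensorTrivialization_mk 𝕂 τ₁ τ₂ hz₁.2 hz₂.2 _ _
  change ‖iteratedFDeriv ℝ k (localRep φ (tensorTrivialization 𝕂 τ₁ τ₂)
    (sectionTensor 𝕂 s t)) (φ y)‖ ≤ _
  rw [(heq.iteratedFDeriv ℝ k).eq_of_nhds]
  have hs := (contDiffAt_localRep hφ h₁.out s hy₁).of_le (m := k) (by exact_mod_cast le_top)
  have ht := (contDiffAt_localRep hφ h₂.out t hy₂).of_le (m := k) (by exact_mod_cast le_top)
  refine (hs.norm_iteratedFDeriv_bilinear_le_mul β ht (H₁ s y hy.1) (H₂ t y hy.2)).trans_eq ?_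
  change _ = (‖β‖ * 2 ^ k) * p s * q t
  ring

end SectionMaps

end

noncomputable section

/-! ### Universal property of the projective topology. -/

section Lift

variable {𝕂 : Type*} [RCLike 𝕂]
  {M : Type*} [AddCommGroup M] [Module 𝕂 M] [Module ℝ M] [IsScalarTower ℝ 𝕂 M]
  {N : Type*} [AddCommGroup N] [Module 𝕂 N] [TopologicalSpace M] [TopologicalSpace N]
  {P : Type*} [AddCommGroup P] [Module 𝕂 P] [Module ℝ P] [IsScalarTower ℝ 𝕂 P]
  [TopologicalSpace P]

/-- The linear map on the tensor product induced by a bilinear map. -/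
def ProjTensor.lift (b : M →ₗ[𝕂] N →ₗ[𝕂] P) : ProjTensor 𝕂 M N →ₗ[𝕂] P := TensorProduct.lift b

/-- The universal property of the projective topology. -/
theorem ProjTensor.continuous_lift [IsTopologicalAddGroup P] [ContinuousSMul 𝕂 P]
    [LocallyConvexSpace ℝ P] {b : M →ₗ[𝕂] N →ₗ[𝕂] P}
    (hb : Continuous fun z : M × N => b z.1 z.2) : Continuous (ProjTensor.lift b) := by
  -- The topology pulled back from `P` is one of those over which the infimum is taken: it is
  -- locally convex, and the bilinear map is continuous for it.
  rw [continuous_iff_le_induced]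
  refine sInf_le ⟨topologicalAddGroup_induced (ProjTensor.lift b), continuousSMul_induced _,
    LocallyConvexSpace.induced ((ProjTensor.lift b).restrictScalars ℝ), continuous_induced_rng.2 hb⟩

end Lift

/-! ### The explicit inverse and the isomorphism. -/

section SectionTensorIso

variable {𝕂 : Type*} [RCLike 𝕂]
  {B : Type*} [NormedAddCommGroup B] [NormedSpace ℝ B]
  {M : Type*} [TopologicalSpace M] [ChartedSpace B M] [IsManifold 𝓘(ℝ, B) ∞ M]
  {F₁ : Type*} [NormedAddCommGroup F₁] [NormedSpace 𝕂 F₁] [NormedSpace ℝ F₁]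
  [IsScalarTower ℝ 𝕂 F₁] [FiniteDimensional 𝕂 F₁]
  {V : M → Type*} [∀ x, AddCommGroup (V x)] [∀ x, Module 𝕂 (V x)] [∀ x, Module ℝ (V x)]
  [∀ x, IsScalarTower ℝ 𝕂 (V x)]
  [TopologicalSpace (TotalSpace F₁ V)] [∀ x, TopologicalSpace (V x)] [FiberBundle F₁ V]
  [VectorBundle 𝕂 F₁ V] [VectorBundle ℝ F₁ V] [ContMDiffVectorBundle ∞ F₁ V 𝓘(ℝ, B)]
  {F₂ : Type*} [NormedAddCommGroup F₂] [NormedSpace 𝕂 F₂] [NormedSpace ℝ F₂]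
  [IsScalarTower ℝ 𝕂 F₂] [FiniteDimensional 𝕂 F₂]
  {W : M → Type*} [∀ x, AddCommGroup (W x)] [∀ x, Module 𝕂 (W x)] [∀ x, Module ℝ (W x)]
  [∀ x, IsScalarTower ℝ 𝕂 (W x)]
  [TopologicalSpace (TotalSpace F₂ W)] [∀ x, TopologicalSpace (W x)] [FiberBundle F₂ W]
  [VectorBundle 𝕂 F₂ W] [VectorBundle ℝ F₂ W] [ContMDiffVectorBundle ∞ F₂ W 𝓘(ℝ, B)]

/-- The smooth function obtained by applying a smooth family of functionals to a section. -/
def pairSection (d : ∀ x, W x →ₗ[𝕂] 𝕂) (hd : ∀ x, SmoothFunctionalAt B F₂ d x)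
    (t : Cₛ^∞⟮𝓘(ℝ, B); F₂, W⟯) : C^∞⟮𝓘(ℝ, B), M; 𝓘(ℝ, 𝕂), 𝕂⟯ :=
  ⟨fun x => d x (t x), fun x => hd x t (t.contMDiff x)⟩

/-- This turns contraction of a pure tensor into multiplication by a smooth function, which the
balancing relation can move to the other factor. -/
theorem contractSection_sectionTensor (d : ∀ x, W x →ₗ[𝕂] 𝕂)
    (hd : ∀ x, SmoothFunctionalAt B F₂ d x) (s : Cₛ^∞⟮𝓘(ℝ, B); F₁, V⟯)
    (t : Cₛ^∞⟮𝓘(ℝ, B); F₂, W⟯) :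
    contractSection 𝕂 d hd (sectionTensor 𝕂 s t) = pairSection d hd t • s := rfl

theorem ContMDiffSection.sum_apply {ι : Type*} (S : Finset ι) (t : ι → Cₛ^∞⟮𝓘(ℝ, B); F₂, W⟯)
    (x : M) : (∑ k ∈ S, t k) x = ∑ k ∈ S, t k x := by
  have h := map_sum (ContMDiffSection.coeAddHom 𝓘(ℝ, B) F₂ ∞ W) t S
  exact (congrFun h x).trans (Finset.sum_apply _ _ _)

variable {m : ℕ} {t : Fin m → Cₛ^∞⟮𝓘(ℝ, B); F₂, W⟯} {d : Fin m → ∀ x, W x →ₗ[𝕂] 𝕂}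

theorem sum_pairSection_smul
    (hd : ∀ k x, SmoothFunctionalAt B F₂ (d k) x) (hsum : ∀ x v, ∑ k, d k x v • t k x = v)
    (u : Cₛ^∞⟮𝓘(ℝ, B); F₂, W⟯) :
    ∑ k, pairSection (d k) (hd k) u • t k = u := by
  ext x
  rw [ContMDiffSection.sum_apply]
  exact hsum x (u x)

/-- The identity is pointwise and linear in the tensor; on `v ⊗ w` it reads `v ⊗ ∑ d_k(w) t_k = v ⊗
w`. -/
theorem sum_sectionTensor_contractSection
    (hd : ∀ k x, SmoothFunctionalAt B F₂ (d k) x) (hsum : ∀ x v, ∑ k, d k x v • t k x = v)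
    (ζ : Cₛ^∞⟮𝓘(ℝ, B); TensorModel 𝕂 F₁ F₂, TensorBundle 𝕂 V W⟯) :
    ∑ k, sectionTensor 𝕂 (contractSection 𝕂 (d k) (hd k) ζ) (t k) = ζ := by
  ext x
  rw [ContMDiffSection.sum_apply]
  change ∑ k, TensorBundle.mk 𝕂 V W x (TensorBundle.contract 𝕂 (d k x) (ζ x)) (t k x) = ζ x
  generalize ζ x = z
  induction z using TensorBundle.induction_on with
  | zero => simp
  | mk v w =>
    simp_rw [TensorBundle.contract_mk, map_smul, LinearMap.smul_apply, ← map_smul, ← map_sum,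
      hsum]
  | add z z' h h' => simp_rw [map_add, LinearMap.add_apply, Finset.sum_add_distrib, h, h']

theorem bijective_sectionTensorMap
    (hd : ∀ k x, SmoothFunctionalAt B F₂ (d k) x) (hsum : ∀ x v, ∑ k, d k x v • t k x = v) :
    Function.Bijective (sectionTensorMap 𝕂 B F₁ V F₂ W) := by
  let ψ : Cₛ^∞⟮𝓘(ℝ, B); TensorModel 𝕂 F₁ F₂, TensorBundle 𝕂 V W⟯ →+
      Cₛ^∞⟮𝓘(ℝ, B); F₁, V⟯ ⊗[C^∞⟮𝓘(ℝ, B), M; 𝓘(ℝ, 𝕂), 𝕂⟯] Cₛ^∞⟮𝓘(ℝ, B); F₂, W⟯ :=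
    { toFun := fun ζ => ∑ k, contractSection 𝕂 (d k) (hd k) ζ ⊗ₜ t k
      map_zero' := by simp
      map_add' := fun ζ ζ' => by simp [TensorProduct.add_tmul, Finset.sum_add_distrib] }
  have hψ (ζ) : ψ ζ = ∑ k, contractSection 𝕂 (d k) (hd k) ζ ⊗ₜ t k := rfl
  have hmk (s : Cₛ^∞⟮𝓘(ℝ, B); F₁, V⟯) (u : Cₛ^∞⟮𝓘(ℝ, B); F₂, W⟯) :
      sectionTensorMap 𝕂 B F₁ V F₂ W (s ⊗ₜ u) = sectionTensor 𝕂 s u := rfl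
  refine Function.bijective_iff_has_inverse.2 ⟨ψ, fun z => ?_, fun ζ => ?_⟩
  · induction z using TensorProduct.induction_on with
    | zero => simp
    | tmul s u =>
      rw [hmk, hψ]
      simp_rw [contractSection_sectionTensor, TensorProduct.smul_tmul]
      rw [← TensorProduct.tmul_sum, sum_pairSection_smul hd hsum]
    | add z z' h h' => rw [map_add, map_add, h, h']
  · rw [hψ, map_sum]
    simp_rw [hmk]
    exact sum_sectionTensor_contractSection hd hsum ζ

/-- The topological isomorphism between the projective tensor product of spaces of sections and
the space of sections of the tensor product bundle. -/
theorem exists_projTensorOver_equiv [LocallyCompactSpace M]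
    (hd : ∀ k x, SmoothFunctionalAt B F₂ (d k) x) (hsum : ∀ x v, ∑ k, d k x v • t k x = v) :
    ∃ Φ : ProjTensorOver 𝕂 Cₛ^∞⟮𝓘(ℝ, B); F₁, V⟯ Cₛ^∞⟮𝓘(ℝ, B); F₂, W⟯
        C^∞⟮𝓘(ℝ, B), M; 𝓘(ℝ, 𝕂), 𝕂⟯ ≃L[𝕂]
          Cₛ^∞⟮𝓘(ℝ, B); TensorModel 𝕂 F₁ F₂, TensorBundle 𝕂 V W⟯,
      ∀ s u, Φ (Submodule.Quotient.mk (ProjTensor.mk 𝕂 Cₛ^∞⟮𝓘(ℝ, B); F₁, V⟯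
        Cₛ^∞⟮𝓘(ℝ, B); F₂, W⟯ s u)) = sectionTensor 𝕂 s u := by
  have := continuousSMul_rclike_sections (𝕂 := 𝕂) (B := B) (F := TensorModel 𝕂 F₁ F₂)
    (V := TensorBundle 𝕂 V W)
  let A := C^∞⟮𝓘(ℝ, B), M; 𝓘(ℝ, 𝕂), 𝕂⟯
  let L := ProjTensor.lift (sectionTensorBilin 𝕂 B F₁ V F₂ W)
  have hL : Continuous L := ProjTensor.continuous_lift (continuous_sectionTensor 𝕂)
  let J := ProjTensor.balancing 𝕂 Cₛ^∞⟮𝓘(ℝ, B); F₁, V⟯ Cₛ^∞⟮𝓘(ℝ, B); F₂, W⟯ A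
  have hJ : J.topologicalClosure ≤ LinearMap.ker L := by
    refine J.topologicalClosure_minimal (Submodule.span_le.2 ?_) (isClosed_singleton.preimage hL)
    rintro _ ⟨a, s, u, rfl⟩
    rw [SetLike.mem_coe, LinearMap.mem_ker, map_sub, sub_eq_zero]
    ext x
    exact (TensorProduct.smul_tmul (R := 𝕂) (a x) (s x) (u x))
  -- The inverse is defined into the tensor product before the quotient, where its continuity
  -- follows from that of `(s, u) ↦ s ⊗ u` with `t k` held fixed.
  let Ψ : Cₛ^∞⟮𝓘(ℝ, B); TensorModel 𝕂 F₁ F₂, TensorBundle 𝕂 V W⟯ →ₗ[𝕂]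
      ProjTensor 𝕂 Cₛ^∞⟮𝓘(ℝ, B); F₁, V⟯ Cₛ^∞⟮𝓘(ℝ, B); F₂, W⟯ :=
    ∑ k, (ProjTensor.mk 𝕂 _ _).flip (t k) ∘ₗ contractSection 𝕂 (d k) (hd k)
  have hΨa (ζ) : Ψ ζ = ∑ k, ProjTensor.mk 𝕂 _ _ (contractSection 𝕂 (d k) (hd k) ζ) (t k) := by
    simp [Ψ, LinearMap.sum_apply]
  have hΨ : Continuous Ψ := by
    refine (continuous_finsetSum Finset.univ fun k _ => (ProjTensor.continuous_mk 𝕂 _ _).comp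
      ((continuous_contractSection 𝕂 (d k) (hd k)).prodMk
        (continuous_const (y := t k)))).congr fun ζ => ?_
    exact (hΨa ζ).symm
  let Φ₀ := J.topologicalClosure.liftQ L hJ
  let Ψ₀ := J.topologicalClosure.mkQ ∘ₗ Ψ
  have h1 : Φ₀ ∘ₗ Ψ₀ = LinearMap.id := by
    ext1 ζ
    change L (Ψ ζ) = ζ
    rw [hΨa, map_sum]
    exact sum_sectionTensor_contractSection hd hsum ζ
  have h2 : Ψ₀ ∘ₗ Φ₀ = LinearMap.id := by
    refine Submodule.linearMap_qext _ (TensorProduct.ext' fun s u => ?_)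
    change J.topologicalClosure.mkQ (Ψ (sectionTensor 𝕂 s u)) =
      J.topologicalClosure.mkQ (ProjTensor.mk 𝕂 _ _ s u)
    -- The two tensors differ by a generator of `J` itself; the closure is needed only for the
    -- quotient to be the stated one.
    have e (k) : J.topologicalClosure.mkQ (ProjTensor.mk 𝕂 _ _
          (contractSection 𝕂 (d k) (hd k) (sectionTensor 𝕂 s u)) (t k)) =
        J.topologicalClosure.mkQ (ProjTensor.mk 𝕂 _ _ s (pairSection (d k) (hd k) u • t k)) :=
      (Submodule.Quotient.eq _).2 <| J.le_topologicalClosure <|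
        Submodule.subset_span ⟨pairSection (d k) (hd k) u, s, t k, rfl⟩
    rw [hΨa, map_sum]
    simp_rw [e]
    rw [← map_sum, ← map_sum, sum_pairSection_smul hd hsum]
  refine ⟨⟨LinearEquiv.ofLinearMap Φ₀ Ψ₀ h1 h2, ?_, ?_⟩, fun s u => rfl⟩
  · exact hL.quotient_lift _
  · exact continuous_quotient_mk'.comp hΨ

end SectionTensorIso

end
theorem theorem6p1 {𝕂 : Type*} [RCLike 𝕂]
    {B : Type*} [NormedAddCommGroup B] [NormedSpace ℝ B] [FiniteDimensional ℝ B]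
    {M : Type*} [TopologicalSpace M] [T2Space M] [SecondCountableTopology M]
    [ChartedSpace B M] [IsManifold 𝓘(ℝ, B) ∞ M]
    {𝔼 : Type*} [NormedAddCommGroup 𝔼] [NormedSpace 𝕂 𝔼] [FiniteDimensional 𝕂 𝔼]
    [NormedSpace ℝ 𝔼] [IsScalarTower ℝ 𝕂 𝔼]
    {E : M → Type*} [∀ x, AddCommGroup (E x)] [∀ x, Module 𝕂 (E x)]
    [∀ x, Module ℝ (E x)] [∀ x, IsScalarTower ℝ 𝕂 (E x)]
    [TopologicalSpace (TotalSpace 𝔼 E)] [∀ x, TopologicalSpace (E x)] [FiberBundle 𝔼 E]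
    [VectorBundle 𝕂 𝔼 E] [VectorBundle ℝ 𝔼 E] [ContMDiffVectorBundle ∞ 𝔼 E 𝓘(ℝ, B)]
    {𝔽 : Type*} [NormedAddCommGroup 𝔽] [NormedSpace 𝕂 𝔽] [FiniteDimensional 𝕂 𝔽]
    [NormedSpace ℝ 𝔽] [IsScalarTower ℝ 𝕂 𝔽]
    {F : M → Type*} [∀ x, AddCommGroup (F x)] [∀ x, Module 𝕂 (F x)]
    [∀ x, Module ℝ (F x)] [∀ x, IsScalarTower ℝ 𝕂 (F x)]
    [TopologicalSpace (TotalSpace 𝔽 F)] [∀ x, TopologicalSpace (F x)] [FiberBundle 𝔽 F]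
    [VectorBundle 𝕂 𝔽 F] [VectorBundle ℝ 𝔽 F] [ContMDiffVectorBundle ∞ 𝔽 F 𝓘(ℝ, B)] :
    Function.Bijective (sectionTensorMap 𝕂 B 𝔼 E 𝔽 F) ∧
      ∃ Φ : ProjTensorOver 𝕂 Cₛ^∞⟮𝓘(ℝ, B); 𝔼, E⟯ Cₛ^∞⟮𝓘(ℝ, B); 𝔽, F⟯
          C^∞⟮𝓘(ℝ, B), M; 𝓘(ℝ, 𝕂), 𝕂⟯ ≃L[𝕂]
            Cₛ^∞⟮𝓘(ℝ, B); TensorModel 𝕂 𝔼 𝔽, TensorBundle 𝕂 E F⟯,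
        ∀ z : Cₛ^∞⟮𝓘(ℝ, B); 𝔼, E⟯ ⊗[C^∞⟮𝓘(ℝ, B), M; 𝓘(ℝ, 𝕂), 𝕂⟯] Cₛ^∞⟮𝓘(ℝ, B); 𝔽, F⟯,
          Φ (ProjTensorOver.ofTensor 𝕂 Cₛ^∞⟮𝓘(ℝ, B); 𝔼, E⟯ Cₛ^∞⟮𝓘(ℝ, B); 𝔽, F⟯
              C^∞⟮𝓘(ℝ, B), M; 𝓘(ℝ, 𝕂), 𝕂⟯ z) =
            sectionTensorMap 𝕂 B 𝔼 E 𝔽 F z := by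
  have : LocallyCompactSpace M := ChartedSpace.locallyCompactSpace B M
  -- One dual basis, for the second factor alone, provides both the algebraic and the topological
  -- inverse.
  obtain ⟨m, t, d, hd, hsum⟩ := exists_dual_basis_sections 𝕂 B 𝔽 F
  refine ⟨bijective_sectionTensorMap hd hsum, ?_⟩
  obtain ⟨Φ, hΦ⟩ := exists_projTensorOver_equiv (F₁ := 𝔼) (V := E) hd hsum
  refine ⟨Φ, fun z => ?_⟩
  induction z using TensorProduct.induction_on with
  | zero => simp
  | tmul s u => exact hΦ s u
  | add z z' h h' => rw [map_add, map_add, map_add, h, h']
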